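/- Let $\mathbb F=\mathbb R$ or $\mathbb F=\mathbb C$, and put $\alpha=1$ if $\mathbb F=\mathbb R$ and $\alpha=0$ if $\mathbb F=\mathbb C$. Let $A\in\mathbb F^{m\times n}$ be an arbitrary matrix, and let $k,s$ be natural numbers with $\alpha<k\le\min\{m,n\}$ and $s\ge 2k+\alpha$. Let $$\Upsilon\in\mathbb F^{k\times m},\qquad \Omega\in\mathbb F^{k\times n},\qquad \Phi\in\mathbb F^{s\times m},\qquad \Psi\in\mathbb F^{s\times n}$$ be independent random matrices, each with independent standard normal entries (a complex standard normal variable is $g_1+\mathrm i g_2$ with $g_1,g_2$ independent real standard normal variables). Form the sketch $$X:=\Upsilon A,\qquad Y:=A\Omega^*,\qquad Z:=\Phi A\Psi^* .$$ Compute thin QR factorizations $X^*=PR_1$ and $Y=QR_2$, where $P\in\mathbb F^{n\times k}$ and $Q\in\mathbb F^{m\times k}$ have orthonormal columns and $R_1,R_2\in\mathbb F^{k\times k}$ are upper triangular; here $P$ and $Q$ are obtained from $X^*$ and $Y$, respectively, by any fixed (measurable, deterministic) rules that return such a factorization for every input. Define $$C:=(\Phi Q)^\dagger\, Z\,\big((\Psi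 P)^\dagger\big)^*\in\mathbb F^{k\times k},\qquad \hat A:=QCP^*,$$ where ${}^\dagger$ is the Moore–Penrose pseudoinverse. For each integer $r\ge 0$ let $\tau_{r+1}^2(A):=\sum_{j>r}\sigma_j^2(A)$ be the tail energy, where $\sigma_1(A)\ge\sigma_2(A)\ge\cdots$ are the singular values of $A$. Then $\|A-\hat A\|_F^2$ is integrable, and $$\mathbb E\,\|A-\hat A\|_F^2\;\le\;\frac{s-\alpha}{s-k-\alpha}\cdot\min_{0\le\varrho<k-\alpha}\frac{k+\varrho-\alpha}{k-\varrho-\alpha}\cdot\tau_{\varrho+1}^2(A),$$ where the minimum is over integers $\varrho$. -/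

import Mathlib

open MeasureTheory ProbabilityTheory
open scoped Matrix

namespace LowRankSketch

/-! ### The scalar field and the standard normal distribution -/

/-- The field-dependent parameter `α`: it is `1` for the real field and `0` for the complex
field. (An `RCLike` field is real exactly when its imaginary unit `RCLike.I` is zero.) -/
noncomputable def alpha (𝕜 : Type*) [RCLike 𝕜] : ℕ :=
  open Classical in if (RCLike.I : 𝕜) = 0 then 1 else 0

lemma alpha_real : alpha ℝ = 1 := by simp [alpha]

lemma alpha_complex : alpha ℂ = 0 := by simp [alpha]

/-- The standard normal distribution on `𝕜`: the law of `g₁ + i g₂` where `g₁, g₂` are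
independent real standard normal variables. Over the real field the imaginary unit `RCLike.I`
is `0`, so that this is the law of `g₁`. -/
noncomputable def stdNormal (𝕜 : Type*) [RCLike 𝕜] : Measure 𝕜 :=
  ((gaussianReal 0 1).prod (gaussianReal 0 1)).map
    fun p : ℝ × ℝ => (p.1 : 𝕜) + (p.2 : 𝕜) * RCLike.I

lemma stdNormal_real : stdNormal ℝ = gaussianReal 0 1 := by
  have h : (fun p : ℝ × ℝ => ((p.1 : ℝ) : ℝ) + (p.2 : ℝ) * RCLike.I) = Prod.fst := by
    funext p; simp
  have h' : stdNormal ℝ = ((gaussianReal 0 1).prod (gaussianReal 0 1)).map Prod.fst := by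
    rw [← h]; rfl
  rw [h', Measure.map_fst_prod]
  simp

/-- Matrices carry the product (entrywise) σ-algebra. -/
instance instMeasurableSpaceMatrix {m n R : Type*} [MeasurableSpace R] :
    MeasurableSpace (Matrix m n R) :=
  inferInstanceAs (MeasurableSpace (m → n → R))

/-- The law of a standard Gaussian `d × N` matrix: the entries are independent and each of them
is standard normal. -/
noncomputable def gaussianMatrix (𝕜 : Type*) [RCLike 𝕜] (d N : ℕ) :
    Measure (Matrix (Fin d) (Fin N) 𝕜) :=
  (Measure.pi fun _ : Fin d => Measure.pi fun _ : Fin N => stdNormal 𝕜 :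
    Measure (Fin d → Fin N → 𝕜))

/-! ### Deterministic linear algebra -/

section LinearAlgebra

variable {𝕜 : Type*} [RCLike 𝕜]

open scoped Matrix.Norms.Frobenius in
/-- The squared Frobenius norm. -/
noncomputable def frobSq {m n : ℕ} (M : Matrix (Fin m) (Fin n) 𝕜) : ℝ := ‖M‖ ^ 2

/-- `tailEnergy A r` is `τ²_{r+1}(A) = ∑_{j > r} σ_j(A)²`, where `σ_1 ≥ σ_2 ≥ ⋯` are the
singular values of `A`. The enumeration of the singular values used here starts at `0`, so that
`σ_j` is the singular value with number `j - 1`. -/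
noncomputable def tailEnergy {m n : ℕ} (A : Matrix (Fin m) (Fin n) 𝕜) (r : ℕ) : ℝ :=
  ∑ j ∈ Finset.Ico r (min m n), (Matrix.toEuclideanLin A).singularValues j ^ 2

/-- The four Penrose equations: `B` is the Moore–Penrose pseudoinverse of `A`. -/
structure IsMoorePenrose {m n : ℕ} (A : Matrix (Fin m) (Fin n) 𝕜)
    (B : Matrix (Fin n) (Fin m) 𝕜) : Prop where
  mul_mul_self : A * B * A = A
  self_mul_mul : B * A * B = B
  isHermitian_left : (A * B).IsHermitian
  isHermitian_right : (B * A).IsHermitian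

theorem IsMoorePenrose.unique {m n : ℕ} {A : Matrix (Fin m) (Fin n) 𝕜}
    {B C : Matrix (Fin n) (Fin m) 𝕜} (hB : IsMoorePenrose A B) (hC : IsMoorePenrose A C) :
    B = C := by
  have e1 : A * B = A * C := by
    have h : A * B = (A * C) * (A * B) := by
      rw [← Matrix.mul_assoc, hC.mul_mul_self]
    have h2 : (A * C) * (A * B) = A * C := by
      have := congrArg Matrix.conjTranspose
        (show (A * B) * (A * C) = A * C by rw [← Matrix.mul_assoc, hB.mul_mul_self])
      rwa [Matrix.conjTranspose_mul, hB.isHermitian_left.eq, hC.isHermitian_left.eq] at this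
    rw [h, h2]
  have e2 : B * A = C * A := by
    have h : B * A = (B * A) * (C * A) := by
      rw [Matrix.mul_assoc B A, ← Matrix.mul_assoc A C A, hC.mul_mul_self]
    have h2 : (B * A) * (C * A) = C * A := by
      have := congrArg Matrix.conjTranspose
        (show (C * A) * (B * A) = C * A by
          rw [Matrix.mul_assoc C A, ← Matrix.mul_assoc A B A, hB.mul_mul_self])
      rwa [Matrix.conjTranspose_mul, hB.isHermitian_right.eq, hC.isHermitian_right.eq] at this
    rw [h, h2]
  calc B = B * A * B := hB.self_mul_mul.symm
    _ = C * A * B := by rw [e2]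
    _ = C * (A * B) := Matrix.mul_assoc _ _ _
    _ = C * A * C := by rw [e1, Matrix.mul_assoc]
    _ = C := hC.self_mul_mul

open scoped ComplexOrder in
theorem exists_isMoorePenrose {m n : ℕ} (A : Matrix (Fin m) (Fin n) 𝕜) :
    ∃ B, IsMoorePenrose A B := by
  have hH : (Aᴴ * A).IsHermitian := Matrix.isHermitian_conjTranspose_mul_self A
  obtain ⟨G, hG, h1, h2, h3⟩ : ∃ G : Matrix (Fin n) (Fin n) 𝕜, G.IsHermitian ∧
      (Aᴴ * A) * G * (Aᴴ * A) = Aᴴ * A ∧ G * (Aᴴ * A) * G = G ∧ (G * (Aᴴ * A)).IsHermitian := by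
    set U : Matrix (Fin n) (Fin n) 𝕜 := (hH.eigenvectorUnitary : Matrix (Fin n) (Fin n) 𝕜)
    have hU : Uᴴ * U = 1 := Unitary.coe_star_mul_self hH.eigenvectorUnitary
    set d : Fin n → 𝕜 := fun i => ((hH.eigenvalues i : ℝ) : 𝕜)
    have hd : ∀ i, star (d i) = d i := fun i => by simp [d]
    have hs : Aᴴ * A = U * Matrix.diagonal d * Uᴴ := by
      conv_lhs => rw [hH.spectral_theorem]
      rfl
    have key : ∀ a b : Fin n → 𝕜, (U * Matrix.diagonal a * Uᴴ) * (U * Matrix.diagonal b * Uᴴ)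
        = U * Matrix.diagonal (fun i => a i * b i) * Uᴴ := by
      intro a b
      rw [← Matrix.diagonal_mul_diagonal]
      calc _ = U * Matrix.diagonal a * (Uᴴ * U) * Matrix.diagonal b * Uᴴ := by
            simp only [Matrix.mul_assoc]
        _ = _ := by rw [hU]; simp only [Matrix.mul_assoc, Matrix.mul_one]
    have herm : ∀ a : Fin n → 𝕜, (∀ i, star (a i) = a i) →
        (U * Matrix.diagonal a * Uᴴ).IsHermitian := by
      intro a ha
      have : star a = a := funext ha
      simp only [Matrix.IsHermitian, Matrix.conjTranspose_mul, Matrix.conjTranspose_conjTranspose,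
        Matrix.diagonal_conjTranspose, this, Matrix.mul_assoc]
    refine ⟨U * Matrix.diagonal (fun i => (d i)⁻¹) * Uᴴ, herm _ fun i => ?_, ?_, ?_, ?_⟩
    · rw [star_inv₀, hd]
    · rw [hs, key, key]
      congr 3
      funext i
      exact mul_inv_mul_cancel (d i)
    · rw [hs, key, key]
      congr 3
      funext i
      by_cases h : d i = 0 <;> simp [h]
    · rw [hs, key]
      refine herm _ fun i => ?_
      rw [star_mul, star_inv₀, hd, mul_comm]
  refine ⟨G * Aᴴ, ?_, ?_, ?_, ?_⟩
  · have h0 : (A * G * Aᴴ * A - A)ᴴ * (A * G * Aᴴ * A - A) = 0 := by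
      have e : (A * G * Aᴴ * A - A)ᴴ = Aᴴ * A * G * Aᴴ - Aᴴ := by
        simp only [Matrix.conjTranspose_sub, Matrix.conjTranspose_mul,
          Matrix.conjTranspose_conjTranspose, hG.eq, Matrix.mul_assoc]
      have e2 : (Aᴴ * A * G * Aᴴ - Aᴴ) * A = 0 := by
        rw [Matrix.sub_mul, Matrix.mul_assoc (Aᴴ * A * G), h1, sub_self]
      have e3 : A * G * Aᴴ * A - A = A * (G * Aᴴ * A - 1) := by
        rw [Matrix.mul_sub, Matrix.mul_one]; simp only [Matrix.mul_assoc]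
      rw [e]
      nth_rewrite 1 [e3]
      rw [← Matrix.mul_assoc, e2, Matrix.zero_mul]
    have h := sub_eq_zero.mp (Matrix.conjTranspose_mul_self_eq_zero.mp h0)
    rwa [← Matrix.mul_assoc A G]
  · calc G * Aᴴ * A * (G * Aᴴ) = G * (Aᴴ * A) * G * Aᴴ := by simp only [Matrix.mul_assoc]
      _ = G * Aᴴ := by rw [h2]
  · simp only [Matrix.IsHermitian, Matrix.conjTranspose_mul, Matrix.conjTranspose_conjTranspose,
      hG.eq, Matrix.mul_assoc]
  · rwa [Matrix.mul_assoc]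

/-- The Moore–Penrose pseudoinverse `A†`, the unique solution of the Penrose equations. -/
noncomputable def pinv {m n : ℕ} (A : Matrix (Fin m) (Fin n) 𝕜) : Matrix (Fin n) (Fin m) 𝕜 :=
  (exists_isMoorePenrose A).choose

theorem pinv_spec {m n : ℕ} (A : Matrix (Fin m) (Fin n) 𝕜) : IsMoorePenrose A (pinv A) :=
  (exists_isMoorePenrose A).choose_spec

/-- `Y = Q R` is a thin QR factorization of the `N × k` matrix `Y`: the `N × k` matrix `Q` has
orthonormal columns and the `k × k` matrix `R` is upper triangular. -/
structure IsThinQR {N k : ℕ} (Y Q : Matrix (Fin N) (Fin k) 𝕜) (R : Matrix (Fin k) (Fin k) 𝕜) :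
    Prop where
  orthonormal : Qᴴ * Q = 1
  upperTriangular : ∀ i j, j < i → R i j = 0
  factorization : Y = Q * R

/-- A (measurable, deterministic) rule that returns the orthonormal factor of some thin QR
factorization of each `N × k` matrix. Thin QR factorizations are not unique, in particular for
rank-deficient matrices; such a rule fixes the choice. -/
structure IsThinQRRule {N k : ℕ} (qr : Matrix (Fin N) (Fin k) 𝕜 → Matrix (Fin N) (Fin k) 𝕜) :
    Prop where
  measurable : Measurable qr
  isThinQR : ∀ Y, ∃ R, IsThinQR Y (qr Y) R

end LinearAlgebra

/-! ### The sketch and the initial approximation -/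

section Sketch

variable {𝕜 : Type*} [RCLike 𝕜] {m n k s : ℕ}

/-- The co-range sketch `X = Υ A`. -/
def corangeSketch (A : Matrix (Fin m) (Fin n) 𝕜) (Υ : Matrix (Fin k) (Fin m) 𝕜) :
    Matrix (Fin k) (Fin n) 𝕜 :=
  Υ * A

/-- The range sketch `Y = A Ω*`. -/
def rangeSketch (A : Matrix (Fin m) (Fin n) 𝕜) (Ω : Matrix (Fin k) (Fin n) 𝕜) :
    Matrix (Fin m) (Fin k) 𝕜 :=
  A * Ωᴴ

/-- The core sketch `Z = Φ A Ψ*`. -/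
def coreSketch (A : Matrix (Fin m) (Fin n) 𝕜) (Φ : Matrix (Fin s) (Fin m) 𝕜)
    (Ψ : Matrix (Fin s) (Fin n) 𝕜) : Matrix (Fin s) (Fin s) 𝕜 :=
  Φ * A * Ψᴴ

/-- The core approximation `C = (Φ Q)† Z ((Ψ P)†)*`. -/
noncomputable def coreApprox (Q : Matrix (Fin m) (Fin k) 𝕜) (P : Matrix (Fin n) (Fin k) 𝕜)
    (Φ : Matrix (Fin s) (Fin m) 𝕜) (Ψ : Matrix (Fin s) (Fin n) 𝕜)
    (Z : Matrix (Fin s) (Fin s) 𝕜) : Matrix (Fin k) (Fin k) 𝕜 :=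
  pinv (Φ * Q) * Z * (pinv (Ψ * P))ᴴ

/-- The initial approximation `Â = Q C P*`, computed from the sketch of `A` with the test matrices
`Υ, Ω, Φ, Ψ`, where `Q` and `P` are the orthonormal factors of thin QR factorizations `Y = Q R₂`
and `X* = P R₁`, returned by the rules `qrQ` and `qrP`. -/
noncomputable def initialApprox (qrQ : Matrix (Fin m) (Fin k) 𝕜 → Matrix (Fin m) (Fin k) 𝕜)
    (qrP : Matrix (Fin n) (Fin k) 𝕜 → Matrix (Fin n) (Fin k) 𝕜)
    (A : Matrix (Fin m) (Fin n) 𝕜)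
    (Υ : Matrix (Fin k) (Fin m) 𝕜) (Ω : Matrix (Fin k) (Fin n) 𝕜)
    (Φ : Matrix (Fin s) (Fin m) 𝕜) (Ψ : Matrix (Fin s) (Fin n) 𝕜) :
    Matrix (Fin m) (Fin n) 𝕜 :=
  let Q := qrQ (rangeSketch A Ω)
  let P := qrP (corangeSketch A Υ)ᴴ
  Q * coreApprox Q P Φ Ψ (coreSketch A Φ Ψ) * Pᴴ

end Sketch

end LowRankSketch

/-! The error `A - Q C Pᴴ` splits orthogonally into the projection error `A - Q Qᴴ A P Pᴴ`, which
depends only on `Υ` and `Ω`, and a core error of size `C - Qᴴ A P` (`frobSq_sub_core`).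

Core error: given `Q` and `P`, the matrix `C` is the outcome of two successive Gaussian
least-squares fits, with `Φ` and then with `Ψ`. Their noise costs on average at most `c = k / (s - k
- α)` times the squared projection error; `s ≥ 2k + α` gives `c ≤ 1`, which absorbs the term of
order `c²`. The prefactor of the theorem is `1 + c` (`lintegral_core_error_le`).

Projection error: fix `ϱ` and let `A₂` be the residual of a truncated SVD. Since `Q` captures the
columns of `A Ωᴴ` and `P` those of `(Υ A)ᴴ`, the projection error is controlled by `A₂` and two
regression errors, one in `Ω` and one in `Υ` (`frobSq_two_sided_projection_le`). Each costs at most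
`c' = ϱ / (k - ϱ - α)` times `‖A₂‖²`, and `1 + 2c'` is the second factor. Averaging over `Υ` with
`Ω` fixed makes `Q` a constant.

Both halves rest on `lintegral_frobSq_add_regression_le`. If `Qᴴ M = 0`, then `X Q` and `X M` are
independent for Gaussian `X`; a reflection kills the cross term, and the mean square reduces to that
of the left inverse of a Gaussian matrix. The latter is bounded in `lintegral_frobSq_leftInv_le`: a
row of the left inverse has norm at most `1 / ‖h‖` with `h` Gaussian of length `s + 1 - k`, and the
mean of `‖h‖⁻²` comes from a Laplace transform.

Laws are compared by characteristic functions, which treats both fields at once. All estimates are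
lower integrals, so integrability follows from the final bound. -/

namespace LowRankSketch

/-! ### Frobenius norm, real inner product and Pythagoras -/

section Frobenius

variable {𝕜 : Type*} [RCLike 𝕜] {m n p k : ℕ}

open scoped Matrix.Norms.Frobenius in
lemma frobSq_eq_sum (M : Matrix (Fin m) (Fin n) 𝕜) : frobSq M = ∑ i, ∑ j, ‖M i j‖ ^ 2 := by
  rw [frobSq, Matrix.frobenius_norm_def, ← Real.sqrt_eq_rpow, Real.sq_sqrt (by positivity)]
  simp

lemma frobSq_nonneg (M : Matrix (Fin m) (Fin n) 𝕜) : 0 ≤ frobSq M := by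
  rw [frobSq_eq_sum]; positivity

@[simp] lemma frobSq_zero : frobSq (0 : Matrix (Fin m) (Fin n) 𝕜) = 0 := by
  simp [frobSq_eq_sum]

lemma frobSq_eq_zero {M : Matrix (Fin m) (Fin n) 𝕜} : frobSq M = 0 ↔ M = 0 := by
  constructor
  · intro h
    rw [frobSq_eq_sum, Finset.sum_eq_zero_iff_of_nonneg (fun i _ => by positivity)] at h
    ext i j
    have h1 := h i (Finset.mem_univ _)
    rw [Finset.sum_eq_zero_iff_of_nonneg (fun i _ => by positivity)] at h1
    simpa using h1 j (Finset.mem_univ _)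
  · rintro rfl; simp

@[simp] lemma frobSq_conjTranspose (M : Matrix (Fin m) (Fin n) 𝕜) : frobSq Mᴴ = frobSq M := by
  rw [frobSq_eq_sum, frobSq_eq_sum, Finset.sum_comm]
  simp [Matrix.conjTranspose_apply]

@[simp] lemma frobSq_neg (M : Matrix (Fin m) (Fin n) 𝕜) : frobSq (-M) = frobSq M := by
  simp [frobSq_eq_sum]

lemma frobSq_smul (c : 𝕜) (M : Matrix (Fin m) (Fin n) 𝕜) :
    frobSq (c • M) = ‖c‖ ^ 2 * frobSq M := by
  simp [frobSq_eq_sum, Finset.mul_sum, mul_pow]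

/-- The real inner product `Re tr (Wᴴ X)` of two matrices. -/
noncomputable def realInner (W X : Matrix (Fin m) (Fin n) 𝕜) : ℝ := RCLike.re (Wᴴ * X).trace

lemma realInner_eq_sum (W X : Matrix (Fin m) (Fin n) 𝕜) :
    realInner W X = ∑ i, ∑ j, RCLike.re (star (W i j) * X i j) := by
  rw [realInner, Matrix.trace, Finset.sum_comm]
  simp [Matrix.mul_apply]

lemma realInner_self (W : Matrix (Fin m) (Fin n) 𝕜) : realInner W W = frobSq W := by
  simp only [realInner_eq_sum, frobSq_eq_sum]
  refine Finset.sum_congr rfl fun i _ => Finset.sum_congr rfl fun j _ => ?_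
  rw [RCLike.star_def, RCLike.conj_mul]
  norm_cast

lemma realInner_comm (W X : Matrix (Fin m) (Fin n) 𝕜) : realInner W X = realInner X W := by
  rw [realInner, realInner, ← Matrix.conjTranspose_conjTranspose W, ← Matrix.conjTranspose_mul,
    Matrix.trace_conjTranspose, Matrix.conjTranspose_conjTranspose]
  simp

lemma realInner_add_left (W W' X : Matrix (Fin m) (Fin n) 𝕜) :
    realInner (W + W') X = realInner W X + realInner W' X := by
  simp [realInner, Matrix.add_mul]

lemma realInner_add_right (W X X' : Matrix (Fin m) (Fin n) 𝕜) :
    realInner W (X + X') = realInner W X + realInner W X' := by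
  simp [realInner, Matrix.mul_add]

lemma realInner_mul_left (B : Matrix (Fin p) (Fin m) 𝕜) (W : Matrix (Fin p) (Fin n) 𝕜)
    (X : Matrix (Fin m) (Fin n) 𝕜) : realInner W (B * X) = realInner (Bᴴ * W) X := by
  simp [realInner, Matrix.mul_assoc]

lemma realInner_mul_right (B : Matrix (Fin n) (Fin p) 𝕜) (W : Matrix (Fin m) (Fin p) 𝕜)
    (X : Matrix (Fin m) (Fin n) 𝕜) : realInner W (X * B) = realInner (W * Bᴴ) X := by
  rw [realInner, realInner, ← Matrix.mul_assoc, Matrix.trace_mul_comm, Matrix.conjTranspose_mul,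
    Matrix.conjTranspose_conjTranspose, Matrix.mul_assoc]

lemma frobSq_add (X Y : Matrix (Fin m) (Fin n) 𝕜) :
    frobSq (X + Y) = frobSq X + frobSq Y + 2 * realInner X Y := by
  rw [← realInner_self, realInner_add_left, realInner_add_right, realInner_add_right,
    realInner_self, realInner_self, realInner_comm Y X]
  ring

lemma frobSq_sub_comm (X Y : Matrix (Fin m) (Fin n) 𝕜) : frobSq (X - Y) = frobSq (Y - X) := by
  rw [← neg_sub, frobSq_neg]

lemma frobSq_add_add_frobSq_sub (X Y : Matrix (Fin m) (Fin n) 𝕜) :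
    frobSq (X + Y) + frobSq (X - Y) = 2 * frobSq X + 2 * frobSq Y := by
  have h : realInner X (-Y) = - realInner X Y := by simp [realInner]
  rw [sub_eq_add_neg, frobSq_add, frobSq_add, h, frobSq_neg]
  ring

lemma frobSq_add_of_left {X Y : Matrix (Fin m) (Fin n) 𝕜} (h : Xᴴ * Y = 0) :
    frobSq (X + Y) = frobSq X + frobSq Y := by
  rw [frobSq_add, realInner, h]; simp

lemma frobSq_add_of_right {X Y : Matrix (Fin m) (Fin n) 𝕜} (h : X * Yᴴ = 0) :
    frobSq (X + Y) = frobSq X + frobSq Y := by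
  rw [← frobSq_conjTranspose, Matrix.conjTranspose_add, frobSq_add_of_left (by simpa using h)]
  simp

lemma frobSq_isometry_mul {Q : Matrix (Fin m) (Fin k) 𝕜} (hQ : Qᴴ * Q = 1)
    (X : Matrix (Fin k) (Fin n) 𝕜) : frobSq (Q * X) = frobSq X := by
  rw [← realInner_self, realInner_mul_left, ← Matrix.mul_assoc, hQ, Matrix.one_mul, realInner_self]

lemma frobSq_mul_conjTranspose_isometry {P : Matrix (Fin n) (Fin k) 𝕜} (hP : Pᴴ * P = 1)
    (X : Matrix (Fin m) (Fin k) 𝕜) : frobSq (X * Pᴴ) = frobSq X := by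
  rw [← frobSq_conjTranspose, Matrix.conjTranspose_mul, Matrix.conjTranspose_conjTranspose,
    frobSq_isometry_mul hP, frobSq_conjTranspose]

/-- Pythagoras for the orthogonal projector `Q Qᴴ` acting from the left. -/
lemma frobSq_split_left {Q : Matrix (Fin m) (Fin k) 𝕜} (hQ : Qᴴ * Q = 1)
    (X : Matrix (Fin m) (Fin n) 𝕜) :
    frobSq X = frobSq (Qᴴ * X) + frobSq (X - Q * (Qᴴ * X)) := by
  have h : (Q * (Qᴴ * X))ᴴ * (X - Q * (Qᴴ * X)) = 0 := by
    rw [Matrix.conjTranspose_mul, Matrix.mul_assoc, Matrix.mul_sub, ← Matrix.mul_assoc Qᴴ Q, hQ,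
      Matrix.one_mul, sub_self, Matrix.mul_zero]
  rw [← frobSq_isometry_mul hQ, ← frobSq_add_of_left h, add_sub_cancel]

/-- Pythagoras for the orthogonal projector `P Pᴴ` acting from the right. -/
lemma frobSq_split_right {P : Matrix (Fin n) (Fin k) 𝕜} (hP : Pᴴ * P = 1)
    (X : Matrix (Fin m) (Fin n) 𝕜) :
    frobSq X = frobSq (X * P) + frobSq (X - X * P * Pᴴ) := by
  rw [← frobSq_conjTranspose X, frobSq_split_left hP, ← frobSq_conjTranspose (X * P),
    ← frobSq_conjTranspose (X - _)]
  simp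

lemma frobSq_conjTranspose_isometry_mul_le {Q : Matrix (Fin m) (Fin k) 𝕜} (hQ : Qᴴ * Q = 1)
    (X : Matrix (Fin m) (Fin n) 𝕜) : frobSq (Qᴴ * X) ≤ frobSq X := by
  rw [frobSq_split_left hQ X]; linarith [frobSq_nonneg (X - Q * (Qᴴ * X))]

lemma frobSq_sub_mul_proj_le {P : Matrix (Fin n) (Fin k) 𝕜} (hP : Pᴴ * P = 1)
    (X : Matrix (Fin m) (Fin n) 𝕜) : frobSq (X - X * P * Pᴴ) ≤ frobSq X := by
  rw [frobSq_split_right hP X]; linarith [frobSq_nonneg (X * P)]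

end Frobenius

/-! ### Measurability of matrix operations -/

section Measurability

variable {𝕜 : Type*} [RCLike 𝕜]

instance instBorelSpaceMatrix {m n : ℕ} : BorelSpace (Matrix (Fin m) (Fin n) 𝕜) :=
  inferInstanceAs (BorelSpace (Fin m → Fin n → 𝕜))

instance instSecondCountableTopologyMatrix {m n : ℕ} :
    SecondCountableTopology (Matrix (Fin m) (Fin n) 𝕜) :=
  inferInstanceAs (SecondCountableTopology (Fin m → Fin n → 𝕜))

variable {S : Type*} [MeasurableSpace S] {m n p : ℕ}

lemma measurable_matrix_iff {f : S → Matrix (Fin m) (Fin n) 𝕜} :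
    Measurable f ↔ ∀ i j, Measurable fun x => f x i j :=
  measurable_pi_iff.trans (forall_congr' fun _ => measurable_pi_iff)

@[fun_prop]
lemma measurable_matrix_mul {f : S → Matrix (Fin m) (Fin n) 𝕜} {g : S → Matrix (Fin n) (Fin p) 𝕜}
    (hf : Measurable f) (hg : Measurable g) : Measurable fun x => f x * g x := by
  have : Continuous fun q : Matrix (Fin m) (Fin n) 𝕜 × Matrix (Fin n) (Fin p) 𝕜 => q.1 * q.2 := by
    fun_prop
  exact this.measurable.comp (hf.prodMk hg)

@[fun_prop]
lemma measurable_matrix_add {f g : S → Matrix (Fin m) (Fin n) 𝕜}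
    (hf : Measurable f) (hg : Measurable g) : Measurable fun x => f x + g x := by
  have : Continuous fun q : Matrix (Fin m) (Fin n) 𝕜 × Matrix (Fin m) (Fin n) 𝕜 => q.1 + q.2 := by
    fun_prop
  exact this.measurable.comp (hf.prodMk hg)

@[fun_prop]
lemma measurable_matrix_sub {f g : S → Matrix (Fin m) (Fin n) 𝕜}
    (hf : Measurable f) (hg : Measurable g) : Measurable fun x => f x - g x := by
  have : Continuous fun q : Matrix (Fin m) (Fin n) 𝕜 × Matrix (Fin m) (Fin n) 𝕜 => q.1 - q.2 := by
    fun_prop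
  exact this.measurable.comp (hf.prodMk hg)

@[fun_prop]
lemma measurable_matrix_conjTranspose {f : S → Matrix (Fin m) (Fin n) 𝕜} (hf : Measurable f) :
    Measurable fun x => (f x)ᴴ := by
  have : Continuous fun q : Matrix (Fin m) (Fin n) 𝕜 => qᴴ := by fun_prop
  exact this.measurable.comp hf

-- By Cramer's formula the inverse is a measurable scalar times a continuous adjugate, singular
-- matrices included.
@[fun_prop]
lemma measurable_matrix_inv {f : S → Matrix (Fin m) (Fin m) 𝕜} (hf : Measurable f) :
    Measurable fun x => (f x)⁻¹ := by
  have h1 : Measurable fun q : Matrix (Fin m) (Fin m) 𝕜 => q.det :=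
    (continuous_id.matrix_det).measurable
  have h2 : Measurable fun q : Matrix (Fin m) (Fin m) 𝕜 => q.adjugate :=
    (continuous_id.matrix_adjugate).measurable
  have h3 : Measurable fun q : Matrix (Fin m) (Fin m) 𝕜 => q⁻¹ := by
    refine measurable_matrix_iff.2 fun i j => ?_
    have : (fun q : Matrix (Fin m) (Fin m) 𝕜 => q⁻¹ i j) = fun q => q.det⁻¹ * q.adjugate i j := by
      funext q
      rw [Matrix.inv_def, Ring.inverse_eq_inv', Matrix.smul_apply, smul_eq_mul]
    rw [this]
    exact h1.inv.mul (measurable_matrix_iff.1 h2 i j)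
  exact h3.comp hf

@[fun_prop]
lemma measurable_frobSq {f : S → Matrix (Fin m) (Fin n) 𝕜} (hf : Measurable f) :
    Measurable fun x => frobSq (f x) := by
  simp only [frobSq_eq_sum]
  have := measurable_matrix_iff.1 hf
  fun_prop

end Measurability

/-! ### Characteristic functions of Gaussian matrices -/

section Laws

variable {𝕜 : Type*} [RCLike 𝕜] {m n p k : ℕ}

instance : IsProbabilityMeasure (stdNormal 𝕜) :=
  Measure.isProbabilityMeasure_map (by fun_prop)

instance instIsProbabilityMeasureGaussianMatrix :
    IsProbabilityMeasure (gaussianMatrix 𝕜 m n) :=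
  inferInstanceAs (IsProbabilityMeasure
    (Measure.pi fun _ : Fin m => Measure.pi fun _ : Fin n => stdNormal 𝕜))

/-- The two terms are the squared coefficients of `g₁` and `g₂` in `Re (star w * z)`. Over the reals
the second vanishes, so one formula serves both fields. -/
lemma re_sq_add_re_star_mul_I_sq (w : 𝕜) :
    RCLike.re w ^ 2 + RCLike.re (star w * RCLike.I) ^ 2 = ‖w‖ ^ 2 := by
  have h : RCLike.re (star w * RCLike.I) = RCLike.im w := by
    simp [RCLike.mul_re, RCLike.I_re]
  rw [RCLike.norm_sq_eq_def, h]
  ring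

lemma charFun_stdNormal (w : 𝕜) :
    ∫ z, Complex.exp (((RCLike.re (star w * z) : ℝ) : ℂ) * Complex.I) ∂(stdNormal 𝕜)
      = Complex.exp (-((‖w‖ ^ 2 / 2 : ℝ) : ℂ)) := by
  rw [stdNormal, integral_map (by fun_prop)
    (by apply Measurable.aestronglyMeasurable; fun_prop)]
  set a := RCLike.re w
  set b := RCLike.re (star w * RCLike.I)
  have e : ∀ q : ℝ × ℝ, Complex.exp (((RCLike.re (star w * ((q.1 : 𝕜) + (q.2 : 𝕜) * RCLike.I)) : ℝ)
        : ℂ) * Complex.I)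
      = Complex.exp (a * q.1 * Complex.I) * Complex.exp (b * q.2 * Complex.I) := by
    intro q
    rw [← Complex.exp_add, ← add_mul]
    congr 2
    rw [mul_add, map_add, mul_comm (star w) (q.1 : 𝕜), mul_left_comm, RCLike.re_ofReal_mul,
      RCLike.re_ofReal_mul]
    simp [a, b, mul_comm]
  simp_rw [e]
  rw [integral_prod_mul (fun x : ℝ => Complex.exp (a * x * Complex.I))
    (fun x : ℝ => Complex.exp (b * x * Complex.I)), ← charFun_apply_real, ← charFun_apply_real,
    charFun_gaussianReal, charFun_gaussianReal, ← Complex.exp_add, ← re_sq_add_re_star_mul_I_sq]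
  congr 1
  push_cast
  simp only [a, b]
  ring

lemma charFun_gaussianMatrix (W : Matrix (Fin m) (Fin n) 𝕜) :
    ∫ X, Complex.exp (((realInner W X : ℝ) : ℂ) * Complex.I) ∂(gaussianMatrix 𝕜 m n)
      = Complex.exp (-((frobSq W / 2 : ℝ) : ℂ)) := by
  have e : ∀ X : Matrix (Fin m) (Fin n) 𝕜, Complex.exp (((realInner W X : ℝ) : ℂ) * Complex.I)
      = ∏ i, ∏ j, Complex.exp (((RCLike.re (star (W i j) * X i j) : ℝ) : ℂ) * Complex.I) := by
    intro X
    rw [realInner_eq_sum]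
    simp only [← Complex.exp_sum, Complex.ofReal_sum, Finset.sum_mul]
  simp_rw [e]
  have h1 := integral_fintype_prod_eq_prod
    (μ := fun _ : Fin m => Measure.pi fun _ : Fin n => stdNormal 𝕜)
    (fun i (x : Fin n → 𝕜) =>
      ∏ j, Complex.exp (((RCLike.re (star (W i j) * x j) : ℝ) : ℂ) * Complex.I))
  refine h1.trans ?_
  have h2 : ∀ i, ∫ x : Fin n → 𝕜,
      ∏ j, Complex.exp (((RCLike.re (star (W i j) * x j) : ℝ) : ℂ) * Complex.I)
        ∂(Measure.pi fun _ : Fin n => stdNormal 𝕜)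
      = ∏ j, Complex.exp (-((‖W i j‖ ^ 2 / 2 : ℝ) : ℂ)) := fun i => by
    rw [integral_fintype_prod_eq_prod (μ := fun _ : Fin n => stdNormal 𝕜)
      (fun j (z : 𝕜) => Complex.exp (((RCLike.re (star (W i j) * z) : ℝ) : ℂ) * Complex.I))]
    simp_rw [charFun_stdNormal]
  simp_rw [h2, ← Complex.exp_sum, frobSq_eq_sum]
  simp [Finset.sum_div, Finset.sum_neg_distrib]

lemma continuous_realInner :
    Continuous fun q : Matrix (Fin m) (Fin n) 𝕜 × Matrix (Fin m) (Fin n) 𝕜 =>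
      realInner q.1 q.2 := by
  unfold realInner
  exact RCLike.continuous_re.comp (by fun_prop)

lemma measurable_realInner (W : Matrix (Fin m) (Fin n) 𝕜) : Measurable (realInner W) :=
  (continuous_realInner.comp (Continuous.prodMk_right W)).measurable

/-- Finite measures on a space of matrices with the same characteristic function are equal. -/
lemma measure_ext_of_charFun {μ ν : Measure (Matrix (Fin m) (Fin n) 𝕜)} [hμ : IsFiniteMeasure μ]
    [hν : IsFiniteMeasure ν]
    (h : ∀ W, ∫ X, Complex.exp (((realInner W X : ℝ) : ℂ) * Complex.I) ∂μ
      = ∫ X, Complex.exp (((realInner W X : ℝ) : ℂ) * Complex.I) ∂ν) : μ = ν := by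
  let b : (Fin m → Fin n → 𝕜) → (Fin m → Fin n → 𝕜) → ℝ :=
    fun X W => ∑ i, ∑ j, RCLike.re (star (W i j) * X i j)
  simp only [realInner_eq_sum] at h
  let L : (Fin m → Fin n → 𝕜) →ₗ[ℝ] (Fin m → Fin n → 𝕜) →ₗ[ℝ] ℝ :=
    LinearMap.mk₂ ℝ b
      (fun X X' W => by simp only [b, Pi.add_apply, mul_add, map_add, Finset.sum_add_distrib])
      (fun c X W => by
        simp only [b, Finset.mul_sum, Pi.smul_apply, mul_smul_comm, RCLike.smul_re, smul_eq_mul])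
      (fun X W W' => by
        simp only [b, Pi.add_apply, star_add, add_mul, map_add, Finset.sum_add_distrib])
      (fun c X W => by
        simp only [b, Finset.mul_sum, Pi.smul_apply, star_smul, smul_mul_assoc, star_trivial,
          RCLike.smul_re, smul_eq_mul])
  have hLb : ∀ X W, L X W = b X W := fun _ _ => rfl
  have hL : Continuous fun q : (Fin m → Fin n → 𝕜) × (Fin m → Fin n → 𝕜) => L q.1 q.2 := by
    simp only [hLb, b]
    refine continuous_finsetSum _ fun i _ => continuous_finsetSum _ fun j _ =>
      RCLike.continuous_re.comp (by fun_prop)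
  -- The pairing is nondegenerate because pairing `v` with itself gives its squared Frobenius norm.
  have hL' : ∀ v ≠ 0, L v ≠ 0 := by
    intro v hv h0
    apply hv
    have h1 : b v v = 0 := by rw [← hLb, h0]; rfl
    have h2 := realInner_eq_sum (Matrix.of v) (Matrix.of v)
    rw [realInner_self] at h2
    exact frobSq_eq_zero.1 (h2.trans h1)
  have key : ∀ P P' : Measure (Fin m → Fin n → 𝕜), IsFiniteMeasure P → IsFiniteMeasure P' →
      (∀ W, ∫ X, Complex.exp (((b X W : ℝ) : ℂ) * Complex.I) ∂P
      = ∫ X, Complex.exp (((b X W : ℝ) : ℂ) * Complex.I) ∂P') → P = P' := by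
    intro P P' _ _ h
    exact ext_of_integral_char_eq Real.continuous_probChar Real.probChar_ne_one hL' hL fun w => h w
  exact key μ ν hμ hν h

end Laws

/-! ### Rotation invariance and independence of orthogonal parts -/

section Invariance

variable {𝕜 : Type*} [RCLike 𝕜] {m n p k : ℕ}

lemma map_eq_gaussianMatrix {E : Type*} [MeasurableSpace E] {ρ : Measure E} [IsFiniteMeasure ρ]
    {T : E → Matrix (Fin m) (Fin n) 𝕜} (hT : Measurable T)
    (h : ∀ W, ∫ x, Complex.exp (((realInner W (T x) : ℝ) : ℂ) * Complex.I) ∂ρ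
      = Complex.exp (-((frobSq W / 2 : ℝ) : ℂ))) :
    ρ.map T = gaussianMatrix 𝕜 m n := by
  refine measure_ext_of_charFun fun W => ?_
  rw [integral_map hT.aemeasurable, h, charFun_gaussianMatrix]
  have := measurable_realInner W
  exact Measurable.aestronglyMeasurable (by fun_prop)

lemma lintegral_gaussianMatrix_isometry_mul {E : Matrix (Fin m) (Fin k) 𝕜} (hE : Eᴴ * E = 1)
    {f : Matrix (Fin k) (Fin n) 𝕜 → ENNReal} (hf : Measurable f) :
    ∫⁻ X, f (Eᴴ * X) ∂(gaussianMatrix 𝕜 m n) = ∫⁻ X, f X ∂(gaussianMatrix 𝕜 k n) := by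
  have hT : Measurable fun X : Matrix (Fin m) (Fin n) 𝕜 => Eᴴ * X := by fun_prop
  rw [← map_eq_gaussianMatrix (ρ := gaussianMatrix 𝕜 m n) hT fun W => ?_, lintegral_map hf hT]
  simp_rw [realInner_mul_left, charFun_gaussianMatrix, Matrix.conjTranspose_conjTranspose,
    frobSq_isometry_mul hE]

lemma lintegral_gaussianMatrix_mul_isometry {B : Matrix (Fin n) (Fin k) 𝕜} (hB : Bᴴ * B = 1)
    {f : Matrix (Fin m) (Fin k) 𝕜 → ENNReal} (hf : Measurable f) :
    ∫⁻ X, f (X * B) ∂(gaussianMatrix 𝕜 m n) = ∫⁻ X, f X ∂(gaussianMatrix 𝕜 m k) := by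
  have hT : Measurable fun X : Matrix (Fin m) (Fin n) 𝕜 => X * B := by fun_prop
  rw [← map_eq_gaussianMatrix (ρ := gaussianMatrix 𝕜 m n) hT fun W => ?_, lintegral_map hf hT]
  simp_rw [realInner_mul_right, charFun_gaussianMatrix, frobSq_mul_conjTranspose_isometry hB]

/-- A Gaussian matrix is invariant under the reflection `2 Q Qᴴ - 1`. -/
lemma lintegral_gaussianMatrix_reflection {Q : Matrix (Fin n) (Fin k) 𝕜} (hQ : Qᴴ * Q = 1)
    {f : Matrix (Fin m) (Fin n) 𝕜 → ENNReal} (hf : Measurable f) :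
    ∫⁻ X, f (X * (Q * Qᴴ) - (X - X * (Q * Qᴴ))) ∂(gaussianMatrix 𝕜 m n)
      = ∫⁻ X, f X ∂(gaussianMatrix 𝕜 m n) := by
  -- The reflection is a Hermitian involution, hence an isometry.
  have hB : (2 • (Q * Qᴴ) - 1)ᴴ * (2 • (Q * Qᴴ) - 1) = 1 := by
    have h : Q * Qᴴ * (Q * Qᴴ) = Q * Qᴴ := by
      rw [Matrix.mul_assoc, ← Matrix.mul_assoc Qᴴ, hQ, Matrix.one_mul]
    simp only [Matrix.conjTranspose_sub, Matrix.conjTranspose_smul, Matrix.conjTranspose_mul,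
      Matrix.conjTranspose_conjTranspose, Matrix.conjTranspose_one, Matrix.mul_sub, Matrix.sub_mul,
      Matrix.smul_mul, Matrix.mul_smul, h, Matrix.one_mul, Matrix.mul_one, star_trivial]
    abel
  rw [← lintegral_gaussianMatrix_mul_isometry hB hf]
  refine lintegral_congr fun X => congrArg f ?_
  rw [Matrix.mul_sub, Matrix.mul_smul, Matrix.mul_one]
  abel

/-- A Gaussian matrix splits into independent parts along the range of an orthonormal `Q` and
its orthogonal complement. -/
lemma lintegral_gaussianMatrix_split {Q : Matrix (Fin n) (Fin k) 𝕜} (hQ : Qᴴ * Q = 1)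
    {f : Matrix (Fin m) (Fin n) 𝕜 → ENNReal} (hf : Measurable f) :
    ∫⁻ X, f X ∂(gaussianMatrix 𝕜 m n) = ∫⁻ X, ∫⁻ G, f (G * Qᴴ + (X - X * Q * Qᴴ))
      ∂(gaussianMatrix 𝕜 m k) ∂(gaussianMatrix 𝕜 m n) := by
  have hT : Measurable fun q : Matrix (Fin m) (Fin n) 𝕜 × Matrix (Fin m) (Fin k) 𝕜 =>
      q.2 * Qᴴ + (q.1 - q.1 * Q * Qᴴ) := by fun_prop
  have h : ((gaussianMatrix 𝕜 m n).prod (gaussianMatrix 𝕜 m k)).map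
      (fun q : Matrix (Fin m) (Fin n) 𝕜 × Matrix (Fin m) (Fin k) 𝕜 =>
        q.2 * Qᴴ + (q.1 - q.1 * Q * Qᴴ)) = gaussianMatrix 𝕜 m n := by
    refine map_eq_gaussianMatrix hT ?_
    intro W
    -- The test matrix splits into its parts off and along `Q`, so the characteristic function
    -- factors; by Pythagoras the two exponents add up to that of `W`.
    have e : ∀ q : Matrix (Fin m) (Fin n) 𝕜 × Matrix (Fin m) (Fin k) 𝕜,
        realInner W (q.2 * Qᴴ + (q.1 - q.1 * Q * Qᴴ))
        = realInner (W - W * Q * Qᴴ) q.1 + realInner (W * Q) q.2 := by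
      intro q
      have h1 : q.1 - q.1 * Q * Qᴴ = q.1 * (1 - Q * Qᴴ) := by
        rw [Matrix.mul_sub, Matrix.mul_one, Matrix.mul_assoc]
      rw [h1, realInner_add_right, realInner_mul_right, realInner_mul_right, add_comm]
      simp [Matrix.mul_sub, Matrix.mul_assoc]
    simp_rw [e, Complex.ofReal_add, add_mul, Complex.exp_add]
    rw [integral_prod_mul
      (fun X => Complex.exp (((realInner (W - W * Q * Qᴴ) X : ℝ) : ℂ) * Complex.I))
      (fun X => Complex.exp (((realInner (W * Q) X : ℝ) : ℂ) * Complex.I)),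
      charFun_gaussianMatrix, charFun_gaussianMatrix, ← Complex.exp_add, frobSq_split_right hQ W]
    congr 1
    push_cast
    ring
  calc ∫⁻ X, f X ∂(gaussianMatrix 𝕜 m n) = ∫⁻ X, f X ∂(((gaussianMatrix 𝕜 m n).prod
        (gaussianMatrix 𝕜 m k)).map (fun q : Matrix (Fin m) (Fin n) 𝕜 × Matrix (Fin m) (Fin k) 𝕜 =>
        q.2 * Qᴴ + (q.1 - q.1 * Q * Qᴴ))) := by rw [h]
    _ = _ := (lintegral_map hf hT).trans (lintegral_prod _ (hf.comp hT).aemeasurable)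


end Invariance

/-! ### Laplace transforms and the inverse moment of a Gaussian vector -/

section Moments

variable {𝕜 : Type*} [RCLike 𝕜] {m n p k : ℕ}

variable (𝕜) in
lemma alpha_eq_zero_or_one :
    (alpha 𝕜 = 1 ∧ (RCLike.I : 𝕜) = 0) ∨ (alpha 𝕜 = 0 ∧ (RCLike.I : 𝕜) ≠ 0) := by
  by_cases h : (RCLike.I : 𝕜) = 0 <;> simp [alpha, h]

lemma norm_ofReal_add_mul_I_sq (x y : ℝ) :
    ‖(x : 𝕜) + (y : 𝕜) * RCLike.I‖ ^ 2 = x ^ 2 + (1 - alpha 𝕜) * y ^ 2 := by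
  rcases alpha_eq_zero_or_one 𝕜 with ⟨h, hI⟩ | ⟨h, hI⟩
  · simp [h, hI]
  · have him : RCLike.im (RCLike.I : 𝕜) = 1 :=
      (RCLike.I_eq_zero_or_im_I_eq_one (K := 𝕜)).resolve_left hI
    rw [RCLike.norm_sq_eq_def, h]
    simp [him]
    ring

lemma integral_exp_neg_mul_sq_gaussianReal {t : ℝ} (ht : 0 ≤ t) :
    ∫ x, Real.exp (-(t * x ^ 2)) ∂(gaussianReal 0 1) = (1 + 2 * t) ^ (-(1 / 2) : ℝ) := by
  rw [integral_gaussianReal_eq_integral_smul one_ne_zero]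
  have e : ∀ x : ℝ, gaussianPDFReal 0 1 x • Real.exp (-(t * x ^ 2))
      = (√(2 * Real.pi))⁻¹ * Real.exp (-(1 / 2 + t) * x ^ 2) := by
    intro x
    rw [gaussianPDFReal, smul_eq_mul, mul_assoc, ← Real.exp_add]
    simp only [NNReal.coe_one, mul_one, sub_zero]
    congr 2
    ring
  simp_rw [e]
  rw [integral_const_mul, integral_gaussian, ← Real.sqrt_inv, ← Real.sqrt_mul (by positivity),
    Real.rpow_neg (by linarith), ← Real.sqrt_eq_rpow, ← Real.sqrt_inv]
  congr 1
  have : Real.pi ≠ 0 := Real.pi_ne_zero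
  have : 1 + 2 * t ≠ 0 := by positivity
  field_simp

lemma integral_exp_neg_mul_norm_sq_stdNormal {t : ℝ} (ht : 0 ≤ t) :
    ∫ z, Real.exp (-(t * ‖z‖ ^ 2)) ∂(stdNormal 𝕜)
      = (1 + 2 * t) ^ (-((2 - alpha 𝕜 : ℝ) / 2)) := by
  rw [stdNormal, integral_map (by fun_prop)
    (by apply Measurable.aestronglyMeasurable; fun_prop)]
  simp_rw [norm_ofReal_add_mul_I_sq, mul_add, neg_add, Real.exp_add]
  rw [integral_prod_mul (fun x : ℝ => Real.exp (-(t * x ^ 2)))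
    (fun x : ℝ => Real.exp (-(t * ((1 - alpha 𝕜 : ℝ) * x ^ 2)))),
    integral_exp_neg_mul_sq_gaussianReal ht]
  rcases alpha_eq_zero_or_one 𝕜 with ⟨h, -⟩ | ⟨h, -⟩
  · norm_num [h]
  · simp only [h, CharP.cast_eq_zero, sub_zero, one_mul]
    rw [integral_exp_neg_mul_sq_gaussianReal ht, ← Real.rpow_add (by linarith)]
    norm_num

/-- The column has `(2 - α) r` independent real normal coordinates, each contributing a factor `(1 +
2t)^(-1/2)`. -/
lemma integral_exp_neg_mul_frobSq {t : ℝ} (ht : 0 ≤ t) (r : ℕ) :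
    ∫ X, Real.exp (-(t * frobSq X)) ∂(gaussianMatrix 𝕜 r 1)
      = (1 + 2 * t) ^ (-((2 - alpha 𝕜 : ℝ) * r / 2)) := by
  have e : ∀ X : Matrix (Fin r) (Fin 1) 𝕜, Real.exp (-(t * frobSq X))
      = ∏ i, ∏ j, Real.exp (-(t * ‖X i j‖ ^ 2)) := by
    intro X
    rw [frobSq_eq_sum]
    simp only [← Real.exp_sum, Finset.mul_sum, Finset.sum_neg_distrib]
  simp_rw [e]
  have h1 := integral_fintype_prod_eq_prod
    (μ := fun _ : Fin r => Measure.pi fun _ : Fin 1 => stdNormal 𝕜)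
    (fun _ (x : Fin 1 → 𝕜) => ∏ j, Real.exp (-(t * ‖x j‖ ^ 2)))
  refine h1.trans ?_
  rw [integral_fintype_prod_eq_prod (μ := fun _ : Fin 1 => stdNormal 𝕜)
      (fun _ (z : 𝕜) => Real.exp (-(t * ‖z‖ ^ 2)))]
  simp_rw [integral_exp_neg_mul_norm_sq_stdNormal ht]
  simp only [Finset.univ_unique, Finset.prod_const, Finset.card_singleton, pow_one,
    Finset.card_univ, Fintype.card_fin]
  rw [← Real.rpow_natCast, ← Real.rpow_mul (by linarith)]
  congr 1
  ring

lemma lintegral_Ioi_one_add_rpow {a : ℝ} (ha : 1 < a) :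
    ∫⁻ t in Set.Ioi (0 : ℝ), ENNReal.ofReal ((1 + 2 * t) ^ (-a))
      = ENNReal.ofReal (1 / (2 * a - 2)) := by
  have hd : ∀ x ∈ Set.Ici (0 : ℝ), HasDerivAt
      (fun t => -(1 / (2 * a - 2)) * (1 + 2 * t) ^ (1 - a)) ((1 + 2 * x) ^ (-a)) x := by
    intro x hx
    have hx' : (0 : ℝ) ≤ x := hx
    have h1 : HasDerivAt (fun t : ℝ => 1 + 2 * t) 2 x := by
      simpa using ((hasDerivAt_id x).const_mul 2).const_add 1
    have h2 := (h1.rpow_const (p := 1 - a) (Or.inl (by positivity))).const_mul (-(1 / (2 * a - 2)))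
    have e1 : 1 - a - 1 = -a := by ring
    have e2 : 2 * a - 2 ≠ 0 := by linarith
    have e3 : -(1 / (2 * a - 2)) * (2 * (1 - a) * (1 + 2 * x) ^ (1 - a - 1))
        = (1 + 2 * x) ^ (-a) := by
      rw [e1, ← mul_assoc, neg_mul, one_div, inv_mul_eq_div, ← neg_div,
        (div_eq_one_iff_eq e2).2 (by ring), one_mul]
    exact e3 ▸ h2
  have ht : Filter.Tendsto (fun t : ℝ => -(1 / (2 * a - 2)) * (1 + 2 * t) ^ (1 - a)) Filter.atTop
      (nhds 0) := by
    have h1 : Filter.Tendsto (fun t : ℝ => 1 + 2 * t) Filter.atTop Filter.atTop :=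
      Filter.tendsto_atTop_add_const_left _ _ (Filter.tendsto_id.const_mul_atTop (by norm_num))
    have h2 := (tendsto_rpow_neg_atTop (show 0 < a - 1 by linarith)).comp h1
    simpa [Function.comp_def] using h2.const_mul (-(1 / (2 * a - 2)))
  have hp : ∀ x ∈ Set.Ioi (0 : ℝ), 0 ≤ (1 + 2 * x) ^ (-a) := fun x hx => by
    have : (0 : ℝ) < x := hx
    positivity
  rw [← ofReal_integral_eq_lintegral_ofReal (integrableOn_Ioi_deriv_of_nonneg' hd hp ht)
    (ae_restrict_of_forall_mem measurableSet_Ioi hp), integral_Ioi_of_hasDerivAt_of_nonneg' hd hp ht]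
  simp

/-- At `x = 0` both sides are `∞`, so the identity can be integrated without removing a null set. -/
lemma lintegral_Ioi_exp_neg_mul {x : ℝ} (hx : 0 ≤ x) :
    ∫⁻ t in Set.Ioi (0 : ℝ), ENNReal.ofReal (Real.exp (-(t * x))) = (ENNReal.ofReal x)⁻¹ := by
  rcases hx.eq_or_lt with rfl | hx
  · simp
  · have e : ∀ t : ℝ, -(t * x) = -x * t := fun t => by ring
    have hi : IntegrableOn (fun t : ℝ => Real.exp (-x * t)) (Set.Ioi 0) :=
      exp_neg_integrableOn_Ioi 0 hx
    simp_rw [e]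
    rw [← ofReal_integral_eq_lintegral_ofReal hi
      (Filter.Eventually.of_forall fun _ => (Real.exp_pos _).le),
      integral_exp_mul_Ioi (by linarith), ← ENNReal.ofReal_inv_of_pos hx]
    simp

/-- Write `1/x` as the integral of `exp (-t x)` over `t > 0` and exchange the integrals. The
condition `hr` is integrability at infinity of the resulting power of `1 + 2t`. -/
lemma lintegral_frobSq_inv {r : ℕ} (hr : 2 < (2 - alpha 𝕜 : ℝ) * r) :
    ∫⁻ X, (ENNReal.ofReal (frobSq X))⁻¹ ∂(gaussianMatrix 𝕜 r 1)
      = ENNReal.ofReal (1 / ((2 - alpha 𝕜) * r - 2)) := by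
  simp_rw [← lintegral_Ioi_exp_neg_mul (frobSq_nonneg _)]
  have hm : Measurable (Function.uncurry fun (X : Matrix (Fin r) (Fin 1) 𝕜) (t : ℝ) =>
      ENNReal.ofReal (Real.exp (-(t * frobSq X)))) := by
    change Measurable fun q : Matrix (Fin r) (Fin 1) 𝕜 × ℝ =>
      ENNReal.ofReal (Real.exp (-(q.2 * frobSq q.1)))
    fun_prop
  rw [lintegral_lintegral_swap hm.aemeasurable]
  have e : ∀ t ∈ Set.Ioi (0 : ℝ), ∫⁻ X, ENNReal.ofReal (Real.exp (-(t * frobSq X)))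
      ∂(gaussianMatrix 𝕜 r 1)
      = ENNReal.ofReal ((1 + 2 * t) ^ (-((2 - alpha 𝕜 : ℝ) * r / 2))) := by
    intro t ht
    have ht' : (0 : ℝ) < t := ht
    rw [← integral_exp_neg_mul_frobSq ht'.le, ofReal_integral_eq_lintegral_ofReal _
      (Filter.Eventually.of_forall fun _ => (Real.exp_pos _).le)]
    refine Integrable.of_bound (C := 1) (Measurable.aestronglyMeasurable (by fun_prop))
      (Filter.Eventually.of_forall fun X => ?_)
    rw [Real.norm_eq_abs, Real.abs_exp, Real.exp_le_one_iff]
    have := frobSq_nonneg X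
    have := mul_nonneg ht'.le this
    linarith
  rw [setLIntegral_congr_fun measurableSet_Ioi e, lintegral_Ioi_one_add_rpow (by linarith)]
  congr 2
  ring

lemma lintegral_norm_sq_stdNormal :
    ∫⁻ z, ENNReal.ofReal (‖z‖ ^ 2) ∂(stdNormal 𝕜) = ENNReal.ofReal (2 - alpha 𝕜) := by
  have hint : Integrable (fun x : ℝ => x ^ 2) (gaussianReal 0 1) :=
    (memLp_id_gaussianReal 2).integrable_sq
  have hval : ∫ x : ℝ, x ^ 2 ∂(gaussianReal 0 1) = 1 := by
    have h := variance_fun_id_gaussianReal (μ := 0) (v := 1)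
    rw [variance_eq_integral measurable_id'.aemeasurable] at h
    simpa using h
  have hα : (0 : ℝ) ≤ 1 - alpha 𝕜 := by
    rcases alpha_eq_zero_or_one 𝕜 with ⟨h, -⟩ | ⟨h, -⟩ <;> simp [h]
  rw [stdNormal, lintegral_map (by fun_prop) (by fun_prop)]
  simp_rw [norm_ofReal_add_mul_I_sq]
  have h1 : Integrable (fun q : ℝ × ℝ => q.1 ^ 2) ((gaussianReal 0 1).prod (gaussianReal 0 1)) :=
    hint.comp_fst _
  have h2 : Integrable (fun q : ℝ × ℝ => q.2 ^ 2) ((gaussianReal 0 1).prod (gaussianReal 0 1)) :=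
    hint.comp_snd _
  rw [← ofReal_integral_eq_lintegral_ofReal
    (f := fun q : ℝ × ℝ => q.1 ^ 2 + (1 - alpha 𝕜 : ℝ) * q.2 ^ 2) (h1.add (h2.const_mul _))
    (Filter.Eventually.of_forall fun q => by positivity)]
  congr 1
  have e1 : ∫ q : ℝ × ℝ, q.1 ^ 2 ∂((gaussianReal 0 1).prod (gaussianReal 0 1)) = 1 := by
    rw [integral_fun_fst (fun x : ℝ => x ^ 2), hval]; simp
  have e2 : ∫ q : ℝ × ℝ, q.2 ^ 2 ∂((gaussianReal 0 1).prod (gaussianReal 0 1)) = 1 := by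
    rw [integral_fun_snd (fun x : ℝ => x ^ 2), hval]; simp
  rw [integral_add h1 (h2.const_mul _), integral_const_mul, e1, e2]
  ring

end Moments

/-! ### Second moment of a Gaussian matrix between fixed factors -/

section SecondMoment

variable {𝕜 : Type*} [RCLike 𝕜] {m n p q : ℕ}

lemma conjTranspose_mul_self_of_frobSq_eq_one {E : Matrix (Fin m) (Fin 1) 𝕜} (h : frobSq E = 1) :
    Eᴴ * E = 1 := by
  have h1 : (Eᴴ * E) 0 0 = ((frobSq E : ℝ) : 𝕜) := by
    simp [Matrix.mul_apply, RCLike.conj_mul, frobSq_eq_sum]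
  ext i j
  rw [Subsingleton.elim i 0, Subsingleton.elim j 0, h1, h]
  simp

lemma exists_isometry_smul (E : Matrix (Fin m) (Fin 1) 𝕜) (hE : E ≠ 0) :
    ∃ F : Matrix (Fin m) (Fin 1) 𝕜, Fᴴ * F = 1 ∧ E = ((√(frobSq E) : ℝ) : 𝕜) • F := by
  have h0 : 0 < frobSq E := lt_of_le_of_ne (frobSq_nonneg E) fun h => hE (frobSq_eq_zero.1 h.symm)
  have h1 : √(frobSq E) ≠ 0 := (Real.sqrt_pos.2 h0).ne'
  refine ⟨((√(frobSq E) : ℝ) : 𝕜)⁻¹ • E, conjTranspose_mul_self_of_frobSq_eq_one ?_, ?_⟩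
  · rw [frobSq_smul, norm_inv, RCLike.norm_ofReal, inv_pow, sq_abs, Real.sq_sqrt h0.le,
      inv_mul_cancel₀ h0.ne']
  · rw [smul_smul, mul_inv_cancel₀ (by simpa using h1), one_smul]

/-- After scaling `L` and `M` to unit columns, rotation invariance leaves a single standard normal
entry, whose second moment is `2 - α`. -/
lemma lintegral_frobSq_vec_mul_mul_vec (L : Matrix (Fin m) (Fin 1) 𝕜)
    (M : Matrix (Fin n) (Fin 1) 𝕜) :
    ∫⁻ X, ENNReal.ofReal (frobSq (Lᴴ * (X * M))) ∂(gaussianMatrix 𝕜 m n)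
      = ENNReal.ofReal (2 - alpha 𝕜) * ENNReal.ofReal (frobSq L * frobSq M) := by
  rcases eq_or_ne L 0 with rfl | hL
  · simp
  rcases eq_or_ne M 0 with rfl | hM
  · simp
  obtain ⟨E, hE, hLE⟩ := exists_isometry_smul L hL
  obtain ⟨F, hF, hMF⟩ := exists_isometry_smul M hM
  have e : ∀ X : Matrix (Fin m) (Fin n) 𝕜, ENNReal.ofReal (frobSq (Lᴴ * (X * M)))
      = ENNReal.ofReal (frobSq L * frobSq M) * ENNReal.ofReal (frobSq (Eᴴ * (X * F))) := by
    intro X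
    rw [← ENNReal.ofReal_mul (mul_nonneg (frobSq_nonneg _) (frobSq_nonneg _))]
    conv_lhs => rw [hLE, hMF]
    rw [Matrix.conjTranspose_smul, Matrix.mul_smul, Matrix.smul_mul, Matrix.mul_smul, frobSq_smul,
      frobSq_smul]
    simp only [RCLike.star_def, RCLike.conj_ofReal, RCLike.norm_ofReal, sq_abs]
    rw [Real.sq_sqrt (frobSq_nonneg _), Real.sq_sqrt (frobSq_nonneg _), mul_assoc]
  simp_rw [e]
  rw [lintegral_const_mul _ (by fun_prop), mul_comm,
    lintegral_gaussianMatrix_mul_isometry hF (f := fun Y => ENNReal.ofReal (frobSq (Eᴴ * Y)))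
      (by fun_prop),
    lintegral_gaussianMatrix_isometry_mul hE (f := fun Y => ENNReal.ofReal (frobSq Y))
      (by fun_prop), ← lintegral_norm_sq_stdNormal]
  congr 1
  have h1 : ∀ Y : Matrix (Fin 1) (Fin 1) 𝕜,
      ENNReal.ofReal (frobSq Y) = ENNReal.ofReal (‖Y 0 0‖ ^ 2) := fun Y => by simp [frobSq_eq_sum]
  simp_rw [h1]
  have mp1 := measurePreserving_eval (fun _ : Fin 1 => Measure.pi fun _ : Fin 1 => stdNormal 𝕜) 0
  have mp2 := measurePreserving_eval (fun _ : Fin 1 => stdNormal 𝕜) 0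
  exact (mp2.comp mp1).lintegral_comp (f := fun z : 𝕜 => ENNReal.ofReal (‖z‖ ^ 2)) (by fun_prop)

/-- Entry `(i, j)` of `L X M` involves only row `i` of `L` and column `j` of `M`, so the case of
vectors sums up. -/
lemma lintegral_frobSq_mul_mul (L : Matrix (Fin q) (Fin m) 𝕜) (M : Matrix (Fin n) (Fin p) 𝕜) :
    ∫⁻ X, ENNReal.ofReal (frobSq (L * (X * M))) ∂(gaussianMatrix 𝕜 m n)
      = ENNReal.ofReal (2 - alpha 𝕜) * ENNReal.ofReal (frobSq L * frobSq M) := by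
  set row : Fin q → Matrix (Fin m) (Fin 1) 𝕜 := fun i => Matrix.of fun a _ => star (L i a)
  set col : Fin p → Matrix (Fin n) (Fin 1) 𝕜 := fun j => Matrix.of fun a _ => M a j
  have hrow : frobSq L = ∑ i, frobSq (row i) := by
    simp [frobSq_eq_sum, row]
  have hcol : frobSq M = ∑ j, frobSq (col j) := by
    rw [frobSq_eq_sum, Finset.sum_comm]; simp [frobSq_eq_sum, col]
  have e : ∀ X : Matrix (Fin m) (Fin n) 𝕜, ENNReal.ofReal (frobSq (L * (X * M)))
      = ∑ i, ∑ j, ENNReal.ofReal (frobSq ((row i)ᴴ * (X * col j))) := by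
    intro X
    rw [frobSq_eq_sum, ENNReal.ofReal_sum_of_nonneg (fun i _ => by positivity)]
    refine Finset.sum_congr rfl fun i _ => ?_
    rw [ENNReal.ofReal_sum_of_nonneg (fun i _ => by positivity)]
    refine Finset.sum_congr rfl fun j _ => ?_
    simp [frobSq_eq_sum, row, col, Matrix.mul_apply]
  calc ∫⁻ X, ENNReal.ofReal (frobSq (L * (X * M))) ∂(gaussianMatrix 𝕜 m n)
      = ∫⁻ X, ∑ i, ∑ j, ENNReal.ofReal (frobSq ((row i)ᴴ * (X * col j))) ∂(gaussianMatrix 𝕜 m n) :=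
        lintegral_congr e
    _ = ∑ i, ∑ j, ∫⁻ X, ENNReal.ofReal (frobSq ((row i)ᴴ * (X * col j)))
          ∂(gaussianMatrix 𝕜 m n) := by
        rw [lintegral_finsetSum _ (fun i _ => by fun_prop)]
        exact Finset.sum_congr rfl fun i _ => lintegral_finsetSum _ (fun j _ => by fun_prop)
    _ = ∑ i, ∑ j, ENNReal.ofReal (2 - alpha 𝕜) *
          (ENNReal.ofReal (frobSq (row i)) * ENNReal.ofReal (frobSq (col j))) := by
        simp_rw [lintegral_frobSq_vec_mul_mul_vec, ENNReal.ofReal_mul (frobSq_nonneg _)]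
    _ = _ := by
        rw [hrow, hcol, ENNReal.ofReal_mul (Finset.sum_nonneg fun i _ => frobSq_nonneg _),
          ENNReal.ofReal_sum_of_nonneg (fun i _ => frobSq_nonneg _),
          ENNReal.ofReal_sum_of_nonneg (fun i _ => frobSq_nonneg _), Finset.sum_mul_sum]
        simp_rw [Finset.mul_sum]

end SecondMoment

/-! ### The left inverse and its rows -/

section LeftInverse

variable {𝕜 : Type*} [RCLike 𝕜] {m n k s r : ℕ}

/-- The left inverse `(Gᴴ G)⁻¹ Gᴴ` of a matrix of full column rank (and `0` otherwise). -/
noncomputable def leftInv (G : Matrix (Fin s) (Fin k) 𝕜) : Matrix (Fin k) (Fin s) 𝕜 :=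
  (Gᴴ * G)⁻¹ * Gᴴ

@[fun_prop]
lemma measurable_leftInv {S : Type*} [MeasurableSpace S] {f : S → Matrix (Fin s) (Fin k) 𝕜}
    (hf : Measurable f) : Measurable fun x => leftInv (f x) := by
  unfold leftInv; fun_prop

lemma leftInv_mul_self {G : Matrix (Fin s) (Fin k) 𝕜} (h : (Gᴴ * G).det ≠ 0) :
    leftInv G * G = 1 := by
  rw [leftInv, Matrix.mul_assoc, Matrix.nonsing_inv_mul _ (isUnit_iff_ne_zero.2 h)]

lemma isHermitian_mul_leftInv (G : Matrix (Fin s) (Fin k) 𝕜) : (G * leftInv G).IsHermitian := by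
  rw [leftInv, ← Matrix.mul_assoc]
  exact Matrix.isHermitian_mul_mul_conjTranspose G (Matrix.isHermitian_conjTranspose_mul_self G).inv

/-- This permits replacing the pseudoinverse, which is given by choice, with an explicit measurable
formula off a null set. -/
lemma pinv_eq_leftInv {G : Matrix (Fin s) (Fin k) 𝕜} (h : (Gᴴ * G).det ≠ 0) :
    pinv G = leftInv G := by
  have h1 := leftInv_mul_self h
  refine (pinv_spec G).unique ⟨?_, ?_, isHermitian_mul_leftInv G, ?_⟩
  · rw [Matrix.mul_assoc, h1, Matrix.mul_one]
  · rw [h1, Matrix.one_mul]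
  · rw [h1]; exact Matrix.isHermitian_one

/-- For full column rank `G * leftInv G` is an orthogonal projector; otherwise the matrix inverse
takes its default value `0` and so does `leftInv G`. -/
lemma frobSq_mul_mul_leftInv_le (G : Matrix (Fin s) (Fin k) 𝕜) (Y : Matrix (Fin n) (Fin s) 𝕜) :
    frobSq (Y * G * leftInv G) ≤ frobSq Y := by
  by_cases h : (Gᴴ * G).det = 0
  · have : leftInv G = 0 := by
      rw [leftInv, Matrix.nonsing_inv_apply_not_isUnit _ (by simp [h]), Matrix.zero_mul]
    rw [this, Matrix.mul_zero, frobSq_zero]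
    exact frobSq_nonneg _
  · have hh := (isHermitian_mul_leftInv G).eq
    have h2 : G * leftInv G * (G * leftInv G) = G * leftInv G := by
      rw [Matrix.mul_assoc, ← Matrix.mul_assoc (leftInv G), leftInv_mul_self h, Matrix.one_mul]
    rw [Matrix.mul_assoc]
    generalize G * leftInv G = T at hh h2 ⊢
    have h3 : Y * T * (Y - Y * T)ᴴ = 0 := by
      rw [Matrix.conjTranspose_sub, Matrix.conjTranspose_mul Y, hh, Matrix.mul_sub,
        ← Matrix.mul_assoc (Y * T) T, Matrix.mul_assoc Y T T, h2, sub_self]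
    have h4 := frobSq_add_of_right h3
    rw [add_sub_cancel] at h4
    linarith [frobSq_nonneg (Y - Y * T)]

/-- If `E` has orthonormal columns and `Eᴴ G = h eᴴ` with `h ≠ 0` then `e` lies in the row space of
`G`, with an explicit preimage. -/
lemma exists_mul_eq_conjTranspose {G : Matrix (Fin s) (Fin k) 𝕜} {E : Matrix (Fin s) (Fin r) 𝕜}
    (hE : Eᴴ * E = 1) {h : Matrix (Fin r) (Fin 1) 𝕜} {e : Matrix (Fin k) (Fin 1) 𝕜}
    (hG : Eᴴ * G = h * eᴴ) (h0 : frobSq h ≠ 0) :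
    ∃ y : Matrix (Fin 1) (Fin s) 𝕜, y * G = eᴴ ∧ frobSq y = (frobSq h)⁻¹ := by
  obtain ⟨F, hF, hhF⟩ := exists_isometry_smul h (fun hz => h0 (by simp [hz]))
  have hs : ((√(frobSq h) : ℝ) : 𝕜) ≠ 0 := by
    simpa using (Real.sqrt_ne_zero (frobSq_nonneg h)).2 h0
  -- With `F = h / ‖h‖` one has `Fᴴ Eᴴ G = Fᴴ h eᴴ = ‖h‖ eᴴ`, so one more division by `‖h‖` gives
  -- the preimage.
  refine ⟨((√(frobSq h) : ℝ) : 𝕜)⁻¹ • (Fᴴ * Eᴴ), ?_, ?_⟩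
  · rw [Matrix.smul_mul, Matrix.mul_assoc, hG]
    nth_rewrite 2 [hhF]
    rw [Matrix.smul_mul, Matrix.mul_smul, ← Matrix.mul_assoc, hF, Matrix.one_mul, smul_smul,
      inv_mul_cancel₀ hs, one_smul]
  · have h1 : frobSq (Fᴴ * Eᴴ) = 1 := by
      rw [frobSq_mul_conjTranspose_isometry hE, frobSq_conjTranspose, ← realInner_self, realInner, hF]
      simp
    rw [frobSq_smul, h1, mul_one, norm_inv, RCLike.norm_ofReal, inv_pow, sq_abs,
      Real.sq_sqrt (frobSq_nonneg _)]

/-- If `y G = eᴴ`, then `eᴴ * leftInv G` is `y` times a projector (or `0`), hence no longer than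
`y`. For `h = 0` the bound is `∞`. -/
lemma frobSq_conjTranspose_mul_leftInv_le {G : Matrix (Fin s) (Fin k) 𝕜}
    {E : Matrix (Fin s) (Fin r) 𝕜} (hE : Eᴴ * E = 1) {h : Matrix (Fin r) (Fin 1) 𝕜}
    {e : Matrix (Fin k) (Fin 1) 𝕜} (hG : Eᴴ * G = h * eᴴ) :
    ENNReal.ofReal (frobSq (eᴴ * leftInv G)) ≤ (ENNReal.ofReal (frobSq h))⁻¹ := by
  by_cases h0 : frobSq h = 0
  · simp [h0]
  obtain ⟨y, hy, hy2⟩ := exists_mul_eq_conjTranspose hE hG h0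
  rw [← ENNReal.ofReal_inv_of_pos (lt_of_le_of_ne (frobSq_nonneg h) (Ne.symm h0)), ← hy2, ← hy]
  exact ENNReal.ofReal_le_ofReal (frobSq_mul_mul_leftInv_le G y)

/-- The columns of a rank-deficient matrix are orthogonal to a large orthonormal family. -/
lemma exists_isometry_conjTranspose_mul_eq_zero (X : Matrix (Fin s) (Fin k) 𝕜)
    {e : Matrix (Fin k) (Fin 1) 𝕜} (he : eᴴ * e = 1) (hX : X * e = 0) :
    ∃ E : Matrix (Fin s) (Fin (s + 1 - k)) 𝕜, Eᴴ * E = 1 ∧ Eᴴ * X = 0 := by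
  set f := Matrix.toEuclideanLin X
  -- The vector `e` lies in the kernel, so the rank is at most `k - 1` and the complement of the
  -- range has dimension at least `s + 1 - k`.
  have hker : 0 < Module.finrank 𝕜 (LinearMap.ker f) := by
    rw [Module.finrank_pos_iff_exists_ne_zero]
    refine ⟨⟨WithLp.toLp 2 fun a => e a 0, ?_⟩, fun h0 => ?_⟩
    · rw [LinearMap.mem_ker]
      ext i
      have := congrFun (congrFun hX i) 0
      simpa [f, Matrix.mul_apply, Matrix.toLpLin_apply, Matrix.mulVec, dotProduct] using this
    · have h1 : e = 0 := by
        ext a b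
        rw [Subsingleton.elim b 0]
        exact congrArg (fun v : EuclideanSpace 𝕜 (Fin k) => v a) (congrArg Subtype.val h0)
      have h2 := congrFun (congrFun he 0) 0
      simp [h1] at h2
  have hsum := LinearMap.finrank_range_add_finrank_ker f
  have horth := Submodule.finrank_add_finrank_orthogonal (LinearMap.range f)
  rw [finrank_euclideanSpace_fin] at hsum horth
  set W := (LinearMap.range f)ᗮ
  have hle : s + 1 - k ≤ Module.finrank 𝕜 W := by omega
  set b := stdOrthonormalBasis 𝕜 W
  refine ⟨Matrix.of fun a i => (b (Fin.castLE hle i) : EuclideanSpace 𝕜 (Fin s)) a, ?_, ?_⟩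
  · ext i j
    have h1 := b.inner_eq_ite (Fin.castLE hle i) (Fin.castLE hle j)
    rw [Submodule.coe_inner, PiLp.inner_apply] at h1
    simp only [Matrix.mul_apply, Matrix.conjTranspose_apply, Matrix.of_apply, Matrix.one_apply]
    simp only [Fin.castLE_inj] at h1
    rw [← h1]
    exact Finset.sum_congr rfl fun a _ => by simp [mul_comm]
  · ext i j
    have h1 : inner 𝕜 (f (EuclideanSpace.single j 1)) (b (Fin.castLE hle i) : EuclideanSpace 𝕜 (Fin s))
        = 0 := (b (Fin.castLE hle i)).2 _ (LinearMap.mem_range_self _ _)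
    rw [inner_eq_zero_symm, PiLp.inner_apply] at h1
    simp only [Matrix.mul_apply, Matrix.conjTranspose_apply, Matrix.of_apply, Matrix.zero_apply]
    rw [← h1]
    exact Finset.sum_congr rfl fun a _ => by simp [f, Matrix.toLpLin_apply, mul_comm]

/-- Bounding `y` by an integer `N` makes the set a projection of a closed set along a compact
factor, hence closed; the whole set is a countable union of these. -/
lemma measurableSet_exists_mul_eq (e : Matrix (Fin 1) (Fin k) 𝕜) :
    MeasurableSet {G : Matrix (Fin s) (Fin k) 𝕜 | ∃ y : Matrix (Fin 1) (Fin s) 𝕜, y * G = e} := by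
  have h : {G : Matrix (Fin s) (Fin k) 𝕜 | ∃ y : Matrix (Fin 1) (Fin s) 𝕜, y * G = e}
      = ⋃ N : ℕ, Prod.snd '' {q : Metric.closedBall (0 : Fin s → 𝕜) N × Matrix (Fin s) (Fin k) 𝕜 |
        (Matrix.of fun _ : Fin 1 => (q.1 : Fin s → 𝕜)) * q.2 = e} := by
    ext G
    simp only [Set.mem_ofPred_eq, Set.mem_iUnion, Set.mem_image, Prod.exists, exists_eq_right]
    constructor
    · rintro ⟨y, hy⟩
      obtain ⟨N, hN⟩ := exists_nat_ge ‖y 0‖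
      refine ⟨N, ⟨y 0, by simpa using hN⟩, ?_⟩
      rw [← hy]
      congr 1
      ext i j
      rw [Subsingleton.elim i 0]; rfl
    · rintro ⟨N, y, hy⟩
      exact ⟨_, hy⟩
  rw [h]
  refine MeasurableSet.iUnion fun N => IsClosed.measurableSet ?_
  refine isClosedMap_snd_of_compactSpace _ (isClosed_eq ?_ continuous_const)
  have h1 : Continuous fun q : Metric.closedBall (0 : Fin s → 𝕜) N × Matrix (Fin s) (Fin k) 𝕜 =>
      (Matrix.of fun _ : Fin 1 => (q.1 : Fin s → 𝕜)) :=
    continuous_pi fun _ => continuous_subtype_val.comp continuous_fst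
  exact h1.matrix_mul continuous_snd

end LeftInverse

/-! ### Mean square of the left inverse and almost sure full rank -/

section InverseMoment

variable {𝕜 : Type*} [RCLike 𝕜] {m n k s p q : ℕ}

/-- The right side counts the real degrees of freedom of `h`; more than two are needed for a finite
inverse moment. -/
lemma two_lt_dof (hs : k + alpha 𝕜 < s) : 2 < (2 - alpha 𝕜 : ℝ) * (s + 1 - k : ℕ) := by
  have h1 : ((s + 1 - k : ℕ) : ℝ) = s + 1 - k := by
    rw [Nat.cast_sub (by omega)]; push_cast; ring
  have h2 : (k : ℝ) + alpha 𝕜 + 1 ≤ s := by exact_mod_cast hs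
  rw [h1]
  rcases alpha_eq_zero_or_one 𝕜 with ⟨h, -⟩ | ⟨h, -⟩ <;> simp only [h] at h2 ⊢ <;> push_cast at h2 ⊢ <;>
    linarith

lemma dof_sub_two (hs : k + alpha 𝕜 < s) :
    (2 - alpha 𝕜 : ℝ) * (s + 1 - k : ℕ) - 2 = (2 - alpha 𝕜) * (s - k - alpha 𝕜) := by
  have h1 : ((s + 1 - k : ℕ) : ℝ) = s + 1 - k := by
    rw [Nat.cast_sub (by omega)]; push_cast; ring
  rw [h1]
  rcases alpha_eq_zero_or_one 𝕜 with ⟨h, -⟩ | ⟨h, -⟩ <;> simp only [h] <;> push_cast <;> ring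

/-- Resampling the column of a Gaussian matrix in the direction `e`. -/
lemma lintegral_le_of_direction {f : Matrix (Fin s) (Fin k) 𝕜 → ENNReal}
    (hf : Measurable f) {e : Matrix (Fin k) (Fin 1) 𝕜} (he : eᴴ * e = 1)
    {g : Matrix (Fin (s + 1 - k)) (Fin 1) 𝕜 → ENNReal} (hg : Measurable g)
    (hfg : ∀ (G : Matrix (Fin s) (Fin k) 𝕜) (E : Matrix (Fin s) (Fin (s + 1 - k)) 𝕜)
      (h : Matrix (Fin (s + 1 - k)) (Fin 1) 𝕜), Eᴴ * E = 1 → Eᴴ * G = h * eᴴ → f G ≤ g h) :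
    ∫⁻ G, f G ∂(gaussianMatrix 𝕜 s k) ≤ ∫⁻ h, g h ∂(gaussianMatrix 𝕜 (s + 1 - k) 1) := by
  rw [lintegral_gaussianMatrix_split he hf]
  -- For fixed `X` the frame `E` is built from the part of `X` orthogonal to `e`, so it does not
  -- depend on the resampled column `x`, and `Eᴴ x` is again standard Gaussian.
  have key : ∀ X : Matrix (Fin s) (Fin k) 𝕜,
      ∫⁻ x, f (x * eᴴ + (X - X * e * eᴴ)) ∂(gaussianMatrix 𝕜 s 1)
        ≤ ∫⁻ h, g h ∂(gaussianMatrix 𝕜 (s + 1 - k) 1) := by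
    intro X
    obtain ⟨E, hE, hEX⟩ := exists_isometry_conjTranspose_mul_eq_zero (X - X * e * eᴴ) he (by
      rw [Matrix.sub_mul, Matrix.mul_assoc _ eᴴ, he, Matrix.mul_one, sub_self])
    rw [← lintegral_gaussianMatrix_isometry_mul hE hg]
    refine lintegral_mono fun x => hfg _ E _ hE ?_
    rw [Matrix.mul_add, hEX, add_zero, Matrix.mul_assoc]
  calc _ ≤ ∫⁻ _ : Matrix (Fin s) (Fin k) 𝕜, ∫⁻ h, g h ∂(gaussianMatrix 𝕜 (s + 1 - k) 1)
        ∂(gaussianMatrix 𝕜 s k) := lintegral_mono key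
    _ = _ := by simp

variable (𝕜) in
/-- The standard basis vector with number `j`, as a column. -/
noncomputable def basisCol (j : Fin k) : Matrix (Fin k) (Fin 1) 𝕜 := Matrix.single j 0 1

lemma basisCol_isometry (j : Fin k) :
    (basisCol 𝕜 j)ᴴ * basisCol 𝕜 j = 1 := by
  unfold basisCol
  ext a b
  rw [Subsingleton.elim a 0, Subsingleton.elim b 0]
  simp

/-- The squared norm is a sum over the `k` rows, and each row is dominated by the inverse square of
a Gaussian vector of length `s + 1 - k`. -/
lemma lintegral_frobSq_leftInv_le (hs : k + alpha 𝕜 < s) :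
    ∫⁻ G, ENNReal.ofReal (frobSq (leftInv G)) ∂(gaussianMatrix 𝕜 s k)
      ≤ ENNReal.ofReal (k / ((2 - alpha 𝕜) * (s - k - alpha 𝕜))) := by
  have e : ∀ G : Matrix (Fin s) (Fin k) 𝕜, ENNReal.ofReal (frobSq (leftInv G))
      = ∑ j : Fin k, ENNReal.ofReal (frobSq ((basisCol 𝕜 j)ᴴ * leftInv G)) := by
    intro G
    rw [← ENNReal.ofReal_sum_of_nonneg (fun _ _ => frobSq_nonneg _), frobSq_eq_sum]
    congr 1
    refine Finset.sum_congr rfl fun j _ => ?_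
    rw [frobSq_eq_sum, Fin.sum_univ_one]
    refine Finset.sum_congr rfl fun b _ => ?_
    rw [Matrix.mul_apply, Finset.sum_eq_single j]
    · simp [basisCol]
    · intro i _ hi
      simp [basisCol, hi.symm]
    · simp
  simp_rw [e]
  rw [lintegral_finsetSum _ (fun i _ => by fun_prop)]
  have hb : ∀ j : Fin k, ∫⁻ G : Matrix (Fin s) (Fin k) 𝕜,
      ENNReal.ofReal (frobSq ((basisCol 𝕜 j)ᴴ * leftInv G))
        ∂(gaussianMatrix 𝕜 s k) ≤ ENNReal.ofReal (1 / ((2 - alpha 𝕜) * (s - k - alpha 𝕜))) := by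
    intro j
    rw [← dof_sub_two hs, ← lintegral_frobSq_inv (two_lt_dof hs)]
    exact lintegral_le_of_direction (by fun_prop) (basisCol_isometry j) (by fun_prop)
      fun G E h hE hG => frobSq_conjTranspose_mul_leftInv_le hE hG
  refine (Finset.sum_le_sum fun j _ => hb j).trans (le_of_eq ?_)
  rw [Finset.sum_const, Finset.card_univ, Fintype.card_fin, nsmul_eq_mul,
    ← ENNReal.ofReal_natCast, ← ENNReal.ofReal_mul (Nat.cast_nonneg _), mul_one_div]

-- Almost surely every basis vector lies in the row space: resampling column `j` fails only if `h =
-- 0`. A vector in the kernel of `G` is then orthogonal to the whole basis.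
open scoped ComplexOrder in
lemma ae_det_ne_zero (hs : k + alpha 𝕜 < s) :
    ∀ᵐ G ∂(gaussianMatrix 𝕜 s k), (Gᴴ * G).det ≠ 0 := by
  have hrow : ∀ j : Fin k, ∀ᵐ G ∂(gaussianMatrix 𝕜 s k), ∃ y : Matrix (Fin 1) (Fin s) 𝕜,
      y * G = (basisCol 𝕜 j)ᴴ := by
    intro j
    set B : Set (Matrix (Fin s) (Fin k) 𝕜) := {G | ∃ y : Matrix (Fin 1) (Fin s) 𝕜,
      y * G = (basisCol 𝕜 j)ᴴ}
    have hB : MeasurableSet B := measurableSet_exists_mul_eq _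
    have hZ : MeasurableSet {h : Matrix (Fin (s + 1 - k)) (Fin 1) 𝕜 | frobSq h = 0} :=
      (measurable_frobSq measurable_id) (measurableSet_singleton 0)
    have hle := lintegral_le_of_direction (f := Bᶜ.indicator 1)
      (measurable_one.indicator hB.compl) (basisCol_isometry (𝕜 := 𝕜) j)
      (g := {h | frobSq h = 0}.indicator 1) (measurable_one.indicator hZ) (by
        intro G E h hE hG
        by_cases h0 : frobSq h = 0
        · rw [Set.indicator_of_mem (s := {h | frobSq h = 0}) h0]
          exact Set.indicator_le_self' (by simp) G
        · obtain ⟨y, hy, -⟩ := exists_mul_eq_conjTranspose hE hG h0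
          have : G ∉ Bᶜ := by rw [Set.notMem_compl_iff]; exact ⟨y, hy⟩
          rw [Set.indicator_of_notMem this]
          exact zero_le)
    rw [lintegral_indicator_one hB.compl, lintegral_indicator_one hZ] at hle
    have hfin := ae_lt_top' (μ := gaussianMatrix 𝕜 (s + 1 - k) 1)
      (f := fun h => (ENNReal.ofReal (frobSq h))⁻¹) (by fun_prop)
      (by rw [lintegral_frobSq_inv (two_lt_dof hs)]; exact ENNReal.ofReal_ne_top)
    -- A finite inverse moment forces `h ≠ 0` almost surely.
    have h0 : (gaussianMatrix 𝕜 (s + 1 - k) 1) {h | frobSq h = 0} = 0 := by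
      refine measure_mono_null ?_ (ae_iff.1 hfin)
      intro h hh
      simp [show frobSq h = 0 from hh]
    exact ae_iff.2 (le_antisymm (hle.trans h0.le) zero_le)
  filter_upwards [ae_all_iff.2 hrow] with G hG hdet
  obtain ⟨v, hv, hv0⟩ := Matrix.exists_mulVec_eq_zero_iff.2 hdet
  have hGv : G.mulVec v = 0 := (Matrix.conjTranspose_mul_self_mulVec_eq_zero G v).1 hv0
  apply hv
  funext j
  obtain ⟨y, hy⟩ := hG j
  have h1 : (y * G).mulVec v 0 = 0 := by
    rw [← Matrix.mulVec_mulVec, hGv, Matrix.mulVec_zero]; rfl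
  rw [hy] at h1
  simpa [basisCol, Matrix.mulVec, dotProduct, Matrix.single_apply] using h1

end InverseMoment

/-! ### Gaussian regression error -/

section Regression

variable {𝕜 : Type*} [RCLike 𝕜] {m n k s p q : ℕ}

lemma ae_det_mul_isometry_ne_zero (hs : k + alpha 𝕜 < s) {Q : Matrix (Fin m) (Fin k) 𝕜}
    (hQ : Qᴴ * Q = 1) :
    ∀ᵐ X ∂(gaussianMatrix 𝕜 s m), ((X * Q)ᴴ * (X * Q)).det ≠ 0 := by
  have hm : MeasurableSet {G : Matrix (Fin s) (Fin k) 𝕜 | (Gᴴ * G).det = 0} :=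
    (isClosed_eq (by fun_prop) continuous_const).measurableSet
  have h := lintegral_gaussianMatrix_mul_isometry (m := s) hQ
    (f := {G | (Gᴴ * G).det = 0}.indicator 1) (measurable_one.indicator hm)
  have h0 := ae_iff.1 (ae_det_ne_zero (𝕜 := 𝕜) hs)
  simp only [not_not] at h0
  rw [lintegral_indicator_one hm, h0] at h
  have hc : Measurable fun X : Matrix (Fin s) (Fin m) 𝕜 =>
      ({G : Matrix (Fin s) (Fin k) 𝕜 | (Gᴴ * G).det = 0}.indicator 1 (X * Q) : ENNReal) :=
    (measurable_one.indicator hm).comp (by fun_prop)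
  filter_upwards [(lintegral_eq_zero_iff hc).1 h] with X hX hdet
  have := Set.indicator_of_mem (s := {G : Matrix (Fin s) (Fin k) 𝕜 | (Gᴴ * G).det = 0}) hdet
    (1 : Matrix (Fin s) (Fin k) 𝕜 → ENNReal)
  simp [this] at hX

/-- By `hM` the factors `X Q` and `X M` are independent. Averaging first over the latter gives `(2 -
α) ‖leftInv G‖² ‖M‖²`, and `2 - α` cancels against the inverse moment. -/
lemma lintegral_frobSq_leftInv_mul_mul_le (hs : k + alpha 𝕜 < s) {Q : Matrix (Fin m) (Fin k) 𝕜}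
    (hQ : Qᴴ * Q = 1) {M : Matrix (Fin m) (Fin p) 𝕜} (hM : Qᴴ * M = 0) :
    ∫⁻ X, ENNReal.ofReal (frobSq (leftInv (X * Q) * (X * M))) ∂(gaussianMatrix 𝕜 s m)
      ≤ ENNReal.ofReal (k / (s - k - alpha 𝕜) * frobSq M) := by
  have hα : (0 : ℝ) < 2 - alpha 𝕜 := by
    rcases alpha_eq_zero_or_one 𝕜 with ⟨h, -⟩ | ⟨h, -⟩ <;> norm_num [h]
  have hpos : (0 : ℝ) < s - k - alpha 𝕜 := by
    have : (k : ℝ) + alpha 𝕜 < s := by exact_mod_cast hs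
    linarith
  rw [lintegral_gaussianMatrix_split hQ (by fun_prop)]
  have e : ∀ (X : Matrix (Fin s) (Fin m) 𝕜) (G : Matrix (Fin s) (Fin k) 𝕜),
      leftInv ((G * Qᴴ + (X - X * Q * Qᴴ)) * Q) * ((G * Qᴴ + (X - X * Q * Qᴴ)) * M)
        = leftInv G * (X * M) := by
    intro X G
    have h1 : (G * Qᴴ + (X - X * Q * Qᴴ)) * Q = G := by
      rw [Matrix.add_mul, Matrix.sub_mul, Matrix.mul_assoc, Matrix.mul_assoc _ Qᴴ, hQ]
      simp
    have h2 : (G * Qᴴ + (X - X * Q * Qᴴ)) * M = X * M := by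
      rw [Matrix.add_mul, Matrix.sub_mul, Matrix.mul_assoc, Matrix.mul_assoc _ Qᴴ, hM]
      simp
    rw [h1, h2]
  simp_rw [e]
  have hmeas : Measurable (Function.uncurry fun (X : Matrix (Fin s) (Fin m) 𝕜)
      (G : Matrix (Fin s) (Fin k) 𝕜) => ENNReal.ofReal (frobSq (leftInv G * (X * M)))) := by
    change Measurable fun q : Matrix (Fin s) (Fin m) 𝕜 × Matrix (Fin s) (Fin k) 𝕜 =>
      ENNReal.ofReal (frobSq (leftInv q.2 * (q.1 * M)))
    fun_prop
  rw [lintegral_lintegral_swap hmeas.aemeasurable]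
  simp_rw [lintegral_frobSq_mul_mul, ENNReal.ofReal_mul (frobSq_nonneg _)]
  rw [lintegral_const_mul _ (by fun_prop), lintegral_mul_const _ (by fun_prop)]
  refine (mul_le_mul_right (mul_le_mul_left (lintegral_frobSq_leftInv_le hs) _) _).trans
    (le_of_eq ?_)
  rw [← ENNReal.ofReal_mul (by positivity), ← ENNReal.ofReal_mul hα.le]
  congr 1
  field_simp

/-- The mean squared error of a Gaussian regression, with an independent offset. -/
lemma lintegral_frobSq_add_regression_le (hs : k + alpha 𝕜 < s) {Q : Matrix (Fin m) (Fin k) 𝕜}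
    (hQ : Qᴴ * Q = 1) {M : Matrix (Fin m) (Fin p) 𝕜} (hM : Qᴴ * M = 0)
    (N : Matrix (Fin q) (Fin p) 𝕜) {B : Matrix (Fin q) (Fin k) 𝕜}
    (hB : ∀ Y : Matrix (Fin k) (Fin p) 𝕜, frobSq (B * Y) ≤ frobSq Y) :
    ∫⁻ X, ENNReal.ofReal (frobSq (N + B * (leftInv (X * Q) * (X * M)))) ∂(gaussianMatrix 𝕜 s m)
      ≤ ENNReal.ofReal (frobSq N + k / (s - k - alpha 𝕜) * frobSq M) := by
  have hpos : (0 : ℝ) < s - k - alpha 𝕜 := by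
    have : (k : ℝ) + alpha 𝕜 < s := by exact_mod_cast hs
    linarith
  set T : Matrix (Fin s) (Fin m) 𝕜 → Matrix (Fin q) (Fin p) 𝕜 := fun X =>
    B * (leftInv (X * Q) * (X * M)) with hT
  have hTm : Measurable T := by fun_prop
  -- The reflection fixes `X Q` and negates `X M`, so it changes the sign of `T`. With the
  -- parallelogram law this removes the cross term without integrating a signed quantity.
  have hrefl : ∫⁻ X, ENNReal.ofReal (frobSq (N - T X)) ∂(gaussianMatrix 𝕜 s m)
      = ∫⁻ X, ENNReal.ofReal (frobSq (N + T X)) ∂(gaussianMatrix 𝕜 s m) := by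
    rw [← lintegral_gaussianMatrix_reflection hQ
      (f := fun X => ENNReal.ofReal (frobSq (N + T X))) (by fun_prop)]
    refine lintegral_congr fun X => ?_
    have h1 : (X * (Q * Qᴴ) - (X - X * (Q * Qᴴ))) * Q = X * Q := by
      rw [Matrix.sub_mul, Matrix.sub_mul, Matrix.mul_assoc X, Matrix.mul_assoc Q, hQ, Matrix.mul_one]
      abel
    have h2 : (X * (Q * Qᴴ) - (X - X * (Q * Qᴴ))) * M = -(X * M) := by
      rw [Matrix.sub_mul, Matrix.sub_mul, Matrix.mul_assoc X, Matrix.mul_assoc Q, hM]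
      simp
    simp only [hT, h1, h2, Matrix.mul_neg, ← sub_eq_add_neg]
  have hpar : ∀ X, ENNReal.ofReal (frobSq (N + T X)) + ENNReal.ofReal (frobSq (N - T X))
      = 2 * (ENNReal.ofReal (frobSq N) + ENNReal.ofReal (frobSq (T X))) := by
    intro X
    rw [← ENNReal.ofReal_add (frobSq_nonneg _) (frobSq_nonneg _), frobSq_add_add_frobSq_sub,
      ← ENNReal.ofReal_add (frobSq_nonneg _) (frobSq_nonneg _), ← mul_add,
      ENNReal.ofReal_mul zero_le_two]
    simp
  have hsum : 2 * ∫⁻ X, ENNReal.ofReal (frobSq (N + T X)) ∂(gaussianMatrix 𝕜 s m)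
      = 2 * ∫⁻ X, (ENNReal.ofReal (frobSq N) + ENNReal.ofReal (frobSq (T X)))
        ∂(gaussianMatrix 𝕜 s m) := by
    rw [← lintegral_const_mul _ (f := fun X => ENNReal.ofReal (frobSq N) +
      ENNReal.ofReal (frobSq (T X))) (by fun_prop), ← lintegral_congr hpar,
      lintegral_add_left (by fun_prop), hrefl, two_mul]
  rw [ENNReal.mul_right_inj two_ne_zero ENNReal.ofNat_ne_top] at hsum
  rw [hsum, lintegral_add_left (by fun_prop),
    ENNReal.ofReal_add (frobSq_nonneg _) (mul_nonneg (by positivity) (frobSq_nonneg _))]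
  refine add_le_add (by simp) (le_trans (lintegral_mono fun X => ?_)
    (lintegral_frobSq_leftInv_mul_mul_le hs hQ hM))
  exact ENNReal.ofReal_le_ofReal (hB _)

end Regression

/-! ### Error of the core approximation -/

section CoreError

variable {𝕜 : Type*} [RCLike 𝕜] {m n k s p q : ℕ}

lemma conjTranspose_mul_sub_proj {Q : Matrix (Fin m) (Fin k) 𝕜} (hQ : Qᴴ * Q = 1)
    (M : Matrix (Fin m) (Fin p) 𝕜) : Qᴴ * (M - Q * (Qᴴ * M)) = 0 := by
  rw [Matrix.mul_sub, ← Matrix.mul_assoc Qᴴ Q, hQ, Matrix.one_mul, sub_self]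

lemma conjTranspose_conjTranspose_sub_proj (P : Matrix (Fin n) (Fin k) 𝕜)
    (X : Matrix (Fin m) (Fin n) 𝕜) : (Xᴴ - P * (Pᴴ * Xᴴ))ᴴ = X - X * P * Pᴴ := by
  simp only [Matrix.conjTranspose_sub, Matrix.conjTranspose_mul, Matrix.conjTranspose_conjTranspose]

/-- Least squares reproduces the part of `M` in the range of `Q` exactly; only the orthogonal part
produces noise. -/
lemma leftInv_mul_mul_eq {Q : Matrix (Fin m) (Fin k) 𝕜} {X : Matrix (Fin s) (Fin m) 𝕜}
    (h : ((X * Q)ᴴ * (X * Q)).det ≠ 0) (M : Matrix (Fin m) (Fin p) 𝕜) :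
    leftInv (X * Q) * (X * M) = Qᴴ * M + leftInv (X * Q) * (X * (M - Q * (Qᴴ * M))) := by
  rw [Matrix.mul_sub, Matrix.mul_sub, ← Matrix.mul_assoc X Q, ← Matrix.mul_assoc _ (X * Q),
    leftInv_mul_self h, Matrix.one_mul, add_sub_cancel]

lemma lintegral_frobSq_add_leftInv_le (hs : k + alpha 𝕜 < s) {Q : Matrix (Fin m) (Fin k) 𝕜}
    (hQ : Qᴴ * Q = 1) {M : Matrix (Fin m) (Fin p) 𝕜} (hM : Qᴴ * M = 0)
    (N : Matrix (Fin k) (Fin p) 𝕜) :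
    ∫⁻ X, ENNReal.ofReal (frobSq (N + leftInv (X * Q) * (X * M))) ∂(gaussianMatrix 𝕜 s m)
      ≤ ENNReal.ofReal (frobSq N + k / (s - k - alpha 𝕜) * frobSq M) := by
  simpa only [Matrix.one_mul] using lintegral_frobSq_add_regression_le hs hQ hM N (B := 1)
    fun Y => by rw [Matrix.one_mul]

/-- The residual of the best core `Qᴴ A P` is orthogonal to every matrix of the form `Q X Pᴴ`. -/
lemma frobSq_sub_core {Q : Matrix (Fin m) (Fin k) 𝕜} (hQ : Qᴴ * Q = 1)
    {P : Matrix (Fin n) (Fin k) 𝕜} (hP : Pᴴ * P = 1) (A : Matrix (Fin m) (Fin n) 𝕜)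
    (C : Matrix (Fin k) (Fin k) 𝕜) :
    frobSq (A - Q * C * Pᴴ)
      = frobSq (A - Q * (Qᴴ * A * P) * Pᴴ) + frobSq (C - Qᴴ * A * P) := by
  set D := Qᴴ * A * P with hD
  have h1 : A - Q * C * Pᴴ = (A - Q * D * Pᴴ) + Q * (D - C) * Pᴴ := by
    rw [Matrix.mul_sub, Matrix.sub_mul]; abel
  have h2 : Qᴴ * ((A - Q * D * Pᴴ) * P) = 0 := by
    rw [Matrix.sub_mul, Matrix.mul_assoc _ Pᴴ, hP, Matrix.mul_one, Matrix.mul_sub,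
      ← Matrix.mul_assoc Qᴴ Q, hQ, Matrix.one_mul, hD, Matrix.mul_assoc, sub_self]
  rw [h1, frobSq_add, realInner_mul_right, realInner_mul_left, Matrix.conjTranspose_conjTranspose,
    h2, frobSq_mul_conjTranspose_isometry hP, frobSq_isometry_mul hQ, frobSq_sub_comm D C]
  simp [realInner]

lemma frobSq_sub_two_sided {Q : Matrix (Fin m) (Fin k) 𝕜} (hQ : Qᴴ * Q = 1)
    (P : Matrix (Fin n) (Fin k) 𝕜) (A : Matrix (Fin m) (Fin n) 𝕜) :
    frobSq (A - Q * (Qᴴ * A * P) * Pᴴ)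
      = frobSq (A - Q * (Qᴴ * A)) + frobSq (Qᴴ * A - Qᴴ * A * P * Pᴴ) := by
  have h1 : A - Q * (Qᴴ * A * P) * Pᴴ
      = (A - Q * (Qᴴ * A)) + Q * (Qᴴ * A - Qᴴ * A * P * Pᴴ) := by
    rw [Matrix.mul_sub, Matrix.mul_assoc Q]; abel
  rw [h1, frobSq_add_of_left, frobSq_isometry_mul hQ]
  rw [← Matrix.mul_assoc, ← Matrix.conjTranspose_conjTranspose Q, ← Matrix.conjTranspose_mul,
    Matrix.conjTranspose_conjTranspose, conjTranspose_mul_sub_proj hQ]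
  simp

/-- The core approximation, computed with `leftInv` in place of the pseudoinverse. -/
noncomputable def coreApproxLeftInv (Q : Matrix (Fin m) (Fin k) 𝕜) (P : Matrix (Fin n) (Fin k) 𝕜)
    (A : Matrix (Fin m) (Fin n) 𝕜) (Φ : Matrix (Fin s) (Fin m) 𝕜) (Ψ : Matrix (Fin s) (Fin n) 𝕜) :
    Matrix (Fin k) (Fin k) 𝕜 :=
  leftInv (Φ * Q) * (Φ * A * Ψᴴ) * (leftInv (Ψ * P))ᴴ

lemma lintegral_core_error_le (hs : 2 * k + alpha 𝕜 ≤ s) (hk : 0 < k)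
    {Q : Matrix (Fin m) (Fin k) 𝕜} (hQ : Qᴴ * Q = 1)
    {P : Matrix (Fin n) (Fin k) 𝕜} (hP : Pᴴ * P = 1) (A : Matrix (Fin m) (Fin n) 𝕜) :
    ∫⁻ Φ, ∫⁻ Ψ, ENNReal.ofReal (frobSq (A - Q * coreApproxLeftInv Q P A Φ Ψ * Pᴴ))
      ∂(gaussianMatrix 𝕜 s n) ∂(gaussianMatrix 𝕜 s m)
      ≤ ENNReal.ofReal ((s - alpha 𝕜) / (s - k - alpha 𝕜) *
          frobSq (A - Q * (Qᴴ * A * P) * Pᴴ)) := by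
  have hs' : k + alpha 𝕜 < s := by omega
  have hpos : (0 : ℝ) < s - k - alpha 𝕜 := by
    have : (k : ℝ) + alpha 𝕜 < s := by exact_mod_cast hs'
    linarith
  set c : ℝ := k / (s - k - alpha 𝕜) with hc
  have hc0 : 0 ≤ c := by positivity
  -- The oversampling `s ≥ 2k + α` is what makes `c ≤ 1`.
  have hc1 : c ≤ 1 := by
    rw [hc, div_le_one hpos]
    have : (2 : ℝ) * k + alpha 𝕜 ≤ s := by exact_mod_cast hs
    linarith
  set R := frobSq (A - Q * (Qᴴ * A * P) * Pᴴ) with hR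
  have hR0 : 0 ≤ R := frobSq_nonneg _
  set A' := A - Q * (Qᴴ * A) with hA'
  have hQA' : Qᴴ * A' = 0 := conjTranspose_mul_sub_proj hQ A
  set F := Qᴴ * A - Qᴴ * A * P * Pᴴ with hF
  have hRsplit : R = frobSq (A' * P) + frobSq (A' - A' * P * Pᴴ) + frobSq F := by
    rw [hR, frobSq_sub_two_sided hQ, frobSq_split_right hP A']
  -- With `Φ` fixed, `Cᴴ` is the `Ψ`-regression of `Wᴴ` on `P`. Its systematic error is `W P - Qᴴ A
  -- P`, and its noise costs `c ‖W - W P Pᴴ‖²`; both are then averaged over `Φ`.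
  have inner_bound : ∀ᵐ Φ ∂(gaussianMatrix 𝕜 s m),
      ∫⁻ Ψ, ENNReal.ofReal (frobSq (A - Q * coreApproxLeftInv Q P A Φ Ψ * Pᴴ))
        ∂(gaussianMatrix 𝕜 s n)
      ≤ ENNReal.ofReal R + (ENNReal.ofReal (frobSq (leftInv (Φ * Q) * (Φ * (A' * P))))
        + ENNReal.ofReal c * ENNReal.ofReal (frobSq
          (F + (leftInv (Φ * Q) * (Φ * (A' - A' * P * Pᴴ)))))) := by
    filter_upwards [ae_det_mul_isometry_ne_zero hs' hQ] with Φ hΦ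
    set W := leftInv (Φ * Q) * (Φ * A) with hW
    have hWeq : W = Qᴴ * A + leftInv (Φ * Q) * (Φ * A') := leftInv_mul_mul_eq hΦ A
    have e1 : leftInv (Φ * Q) * (Φ * (A' * P)) = (Pᴴ * Wᴴ - (Qᴴ * A * P)ᴴ)ᴴ := by
      rw [Matrix.conjTranspose_sub, Matrix.conjTranspose_mul,
        Matrix.conjTranspose_conjTranspose, Matrix.conjTranspose_conjTranspose,
        Matrix.conjTranspose_conjTranspose, hWeq, Matrix.add_mul, add_sub_cancel_left]
      simp only [Matrix.mul_assoc]
    have e2 : F + (leftInv (Φ * Q) * (Φ * (A' - A' * P * Pᴴ)))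
        = (Wᴴ - P * (Pᴴ * Wᴴ))ᴴ := by
      rw [conjTranspose_conjTranspose_sub_proj, hF, hWeq, Matrix.mul_sub, Matrix.mul_sub,
        Matrix.add_mul, Matrix.add_mul]
      simp only [Matrix.mul_assoc]
      abel
    rw [e1, e2, frobSq_conjTranspose, frobSq_conjTranspose, ← ENNReal.ofReal_mul hc0,
      ← ENNReal.ofReal_add (frobSq_nonneg _) (mul_nonneg hc0 (frobSq_nonneg _))]
    have hreg := lintegral_frobSq_add_leftInv_le hs' hP
      (conjTranspose_mul_sub_proj hP Wᴴ) (Pᴴ * Wᴴ - (Qᴴ * A * P)ᴴ)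
    have hae : ∀ᵐ Ψ ∂(gaussianMatrix 𝕜 s n),
        ENNReal.ofReal (frobSq (A - Q * coreApproxLeftInv Q P A Φ Ψ * Pᴴ))
        = ENNReal.ofReal R + ENNReal.ofReal (frobSq (Pᴴ * Wᴴ - (Qᴴ * A * P)ᴴ +
          (leftInv (Ψ * P) * (Ψ * (Wᴴ - P * (Pᴴ * Wᴴ)))))) := by
      filter_upwards [ae_det_mul_isometry_ne_zero hs' hP] with Ψ hΨ
      have e3 : coreApproxLeftInv Q P A Φ Ψ = (leftInv (Ψ * P) * (Ψ * Wᴴ))ᴴ := by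
        simp only [coreApproxLeftInv, hW, Matrix.conjTranspose_mul,
          Matrix.conjTranspose_conjTranspose, Matrix.mul_assoc]
      rw [frobSq_sub_core hQ hP, ENNReal.ofReal_add hR0 (frobSq_nonneg _), e3,
        leftInv_mul_mul_eq hΨ]
      congr 2
      rw [← frobSq_conjTranspose, Matrix.conjTranspose_sub, Matrix.conjTranspose_conjTranspose]
      congr 1
      abel
    rw [lintegral_congr_ae hae, lintegral_add_left (by fun_prop)]
    exact add_le_add (by simp) hreg
  have hr1 := lintegral_frobSq_leftInv_mul_mul_le hs' hQ (M := A' * P)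
    (by rw [← Matrix.mul_assoc, hQA', Matrix.zero_mul])
  have hr2 := lintegral_frobSq_add_leftInv_le hs' hQ (M := A' - A' * P * Pᴴ)
    (by rw [Matrix.mul_sub, Matrix.mul_assoc, ← Matrix.mul_assoc, hQA']; simp) F
  refine (lintegral_mono_ae inner_bound).trans ?_
  rw [lintegral_add_left (by fun_prop), lintegral_add_left (by fun_prop),
    lintegral_const_mul _ (by fun_prop)]
  refine (add_le_add (le_of_eq (by simp)) (add_le_add hr1 (mul_le_mul_right hr2 _))).trans
    (b := ENNReal.ofReal R + (ENNReal.ofReal _ + ENNReal.ofReal c * ENNReal.ofReal _)) ?_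
  have n1 := frobSq_nonneg (A' * P)
  have n2 := frobSq_nonneg (A' - A' * P * Pᴴ)
  have n3 := frobSq_nonneg F
  rw [← hc, ← ENNReal.ofReal_mul hc0,
    ← ENNReal.ofReal_add (by positivity) (by positivity),
    ← ENNReal.ofReal_add (by positivity) (by positivity)]
  refine ENNReal.ofReal_le_ofReal ?_
  have e4 : ((s : ℝ) - alpha 𝕜) / (s - k - alpha 𝕜) = 1 + c := by
    rw [hc]; field_simp; ring
  rw [e4, hRsplit]
  -- The only slack is in the part regressed twice, which carries `c²` and is bounded with `c`.
  have := mul_nonneg (mul_nonneg hc0 n2) (sub_nonneg.2 hc1)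
  nlinarith

end CoreError

/-! ### Truncated singular value decomposition -/

section TruncatedSVD

variable {𝕜 : Type*} [RCLike 𝕜] {m n : ℕ}

lemma exists_right_singular_basis (A : Matrix (Fin m) (Fin n) 𝕜) :
    ∃ V : Matrix (Fin n) (Fin n) 𝕜, Vᴴ * V = 1 ∧ ∀ i j, (Aᴴ * (A * V)) i j
      = V i j * (((Matrix.toEuclideanLin A).singularValues j ^ 2 : ℝ) : 𝕜) := by
  set T := Matrix.toEuclideanLin A with hT
  have hn : Module.finrank 𝕜 (EuclideanSpace 𝕜 (Fin n)) = n := finrank_euclideanSpace_fin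
  set b := T.isSymmetric_adjoint_comp_self.eigenvectorBasis hn with hb
  refine ⟨Matrix.of fun a i => b i a, ?_, fun i j => ?_⟩
  · ext i j
    have h1 := b.inner_eq_ite i j
    rw [PiLp.inner_apply] at h1
    simp only [Matrix.mul_apply, Matrix.conjTranspose_apply, Matrix.of_apply, Matrix.one_apply]
    rw [← h1]
    exact Finset.sum_congr rfl fun a _ => by simp [mul_comm]
  · have h1 := T.isSymmetric_adjoint_comp_self.apply_eigenvectorBasis hn j
    rw [← hb, ← T.sq_singularValues_fin hn, LinearMap.comp_apply, hT,
      ← Matrix.toEuclideanLin_conjTranspose_eq_adjoint] at h1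
    have h2 := congrArg (fun v : EuclideanSpace 𝕜 (Fin n) => v i) h1
    simp only [Matrix.toLpLin_apply, PiLp.smul_apply, smul_eq_mul] at h2
    rw [mul_comm]
    refine Eq.trans ?_ h2
    simp [Matrix.mul_apply, Matrix.mulVec, dotProduct]

/-- A truncated singular value decomposition: the projectors `U Uᴴ` and `V Vᴴ` onto dominant left
and right singular subspaces satisfy `U Uᴴ A = A V Vᴴ`, and the error is the tail energy. -/
lemma exists_truncated_svd (A : Matrix (Fin m) (Fin n) 𝕜) {r : ℕ} (hrm : r ≤ m) (hrn : r ≤ n) :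
    ∃ (d : ℕ) (_ : d ≤ r) (U : Matrix (Fin m) (Fin d) 𝕜) (V : Matrix (Fin n) (Fin d) 𝕜),
      Uᴴ * U = 1 ∧ Vᴴ * V = 1 ∧ U * (Uᴴ * A) = A * V * Vᴴ ∧
      frobSq (A - A * V * Vᴴ) = tailEnergy A r := by
  obtain ⟨W, hW, hAW⟩ := exists_right_singular_basis A
  set T := Matrix.toEuclideanLin A
  set σ := T.singularValues
  set rk := Module.finrank 𝕜 (LinearMap.range T)
  have hpos : ∀ i, 0 < σ i ↔ i < rk := fun i => T.singularValues_pos_iff_lt_finrank_range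
  have hzero : ∀ i, rk ≤ i → σ i = 0 := fun i hi =>
    T.singularValues_eq_zero_iff_le_finrank_range.2 hi
  have hrkm : rk ≤ m := by
    have := Submodule.finrank_le (LinearMap.range T)
    rwa [finrank_euclideanSpace_fin] at this
  have hrkn : rk ≤ n := by
    have := LinearMap.finrank_range_le T
    rwa [finrank_euclideanSpace_fin] at this
  have hcols : ∀ (d : ℕ) (hd : d ≤ n), ∃ V : Matrix (Fin n) (Fin d) 𝕜,
      Vᴴ * V = 1 ∧
      Aᴴ * (A * V) = V * Matrix.diagonal fun j : Fin d => ((σ j ^ 2 : ℝ) : 𝕜) := by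
    intro d hd
    refine ⟨Matrix.of fun i j => W i (Fin.castLE hd j), ?_, ?_⟩
    · ext i j
      have := congrFun (congrFun hW (Fin.castLE hd i)) (Fin.castLE hd j)
      simpa [Matrix.mul_apply, Matrix.one_apply] using this
    · ext i j
      rw [Matrix.mul_diagonal]
      have := hAW i (Fin.castLE hd j)
      simpa [Matrix.mul_apply] using this
  have hgram : ∀ {d : ℕ} {V : Matrix (Fin n) (Fin d) 𝕜}, Vᴴ * V = 1 →
      Aᴴ * (A * V) = V * (Matrix.diagonal fun j : Fin d => ((σ j ^ 2 : ℝ) : 𝕜)) →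
      (A * V)ᴴ * (A * V) = Matrix.diagonal fun j : Fin d => ((σ j ^ 2 : ℝ) : 𝕜) := by
    intro d V hV hAV
    rw [Matrix.conjTranspose_mul, Matrix.mul_assoc, hAV, ← Matrix.mul_assoc, hV, Matrix.one_mul]
  have hfrob : ∀ {d : ℕ} {V : Matrix (Fin n) (Fin d) 𝕜}, Vᴴ * V = 1 →
      Aᴴ * (A * V) = V * (Matrix.diagonal fun j : Fin d => ((σ j ^ 2 : ℝ) : 𝕜)) →
      frobSq (A * V) = ∑ j ∈ Finset.range d, σ j ^ 2 := by
    intro d V hV hAV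
    rw [← realInner_self, realInner, hgram hV hAV, Matrix.trace_diagonal, map_sum,
      Finset.sum_range]
    simp only [RCLike.ofReal_re]
  have hdn : min r rk ≤ n := (min_le_left _ _).trans hrn
  obtain ⟨V, hV, hAV⟩ := hcols (min r rk) hdn
  obtain ⟨V', hV', hAV'⟩ := hcols n le_rfl
  have hσ : ∀ j : Fin (min r rk), ((σ j : ℝ) : 𝕜) ≠ 0 := fun j => by
    have : 0 < σ j := (hpos j).2 (lt_of_lt_of_le j.2 (min_le_right _ _))
    exact_mod_cast this.ne'
  set D : Matrix (Fin (min r rk)) (Fin (min r rk)) 𝕜 :=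
    Matrix.diagonal fun j => ((σ j : ℝ) : 𝕜)⁻¹ with hD
  have hDH : Dᴴ = D := by
    rw [hD, Matrix.diagonal_conjTranspose]
    congr 1
    funext j
    simp
  -- The left singular vectors are `σ_j⁻¹ A v_j`, so the truncation stops at the rank, where the
  -- singular values are still positive.
  refine ⟨min r rk, min_le_left _ _, A * V * D, V, ?_, hV, ?_, ?_⟩
  · rw [Matrix.conjTranspose_mul, hDH, Matrix.mul_assoc, ← Matrix.mul_assoc (A * V)ᴴ, hgram hV hAV, hD,
      Matrix.diagonal_mul_diagonal, Matrix.diagonal_mul_diagonal, ← Matrix.diagonal_one]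
    congr 1
    funext j
    have := hσ j
    push_cast
    field_simp
  · have h1 : (A * V)ᴴ * A = (Matrix.diagonal fun j : Fin (min r rk) => ((σ j ^ 2 : ℝ) : 𝕜)) * Vᴴ := by
      have := congrArg Matrix.conjTranspose hAV
      rw [Matrix.conjTranspose_mul, Matrix.conjTranspose_conjTranspose, Matrix.conjTranspose_mul V,
        Matrix.diagonal_conjTranspose] at this
      rw [this]
      congr 2
      funext j
      simp
    rw [Matrix.conjTranspose_mul, hDH, Matrix.mul_assoc D, h1, Matrix.mul_assoc (A * V)]
    congr 1
    rw [← Matrix.mul_assoc, ← Matrix.mul_assoc, hD, Matrix.diagonal_mul_diagonal,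
      Matrix.diagonal_mul_diagonal]
    have : (fun j : Fin (min r rk) => ((σ j : ℝ) : 𝕜)⁻¹ * ((σ j : ℝ) : 𝕜)⁻¹ * ((σ j ^ 2 : ℝ) : 𝕜))
        = fun _ => 1 := by
      funext j
      have := hσ j
      push_cast
      field_simp
    rw [this, Matrix.diagonal_one, Matrix.one_mul]
  · have h1 := frobSq_split_right hV A
    have h2 : frobSq A = frobSq (A * V') := by
      have hV'' : V'ᴴᴴ * V'ᴴ = 1 := by
        rw [Matrix.conjTranspose_conjTranspose]; exact mul_eq_one_comm.1 hV'
      have := frobSq_mul_conjTranspose_isometry hV'' A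
      rw [Matrix.conjTranspose_conjTranspose] at this
      exact this.symm
    rw [h2, hfrob hV hAV, hfrob hV' hAV'] at h1
    have h3 : ∑ j ∈ Finset.range n, σ j ^ 2 = ∑ j ∈ Finset.range (min m n), σ j ^ 2 := by
      refine (Finset.sum_subset (Finset.range_mono (min_le_right _ _)) fun j _ hj => ?_).symm
      have : rk ≤ j := by simp at hj; omega
      rw [hzero j this]; norm_num
    have h4 : ∑ j ∈ Finset.range r, σ j ^ 2 = ∑ j ∈ Finset.range (min r rk), σ j ^ 2 := by
      refine (Finset.sum_subset (Finset.range_mono (min_le_left _ _)) fun j hj hj' => ?_).symm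
      have : rk ≤ j := by simp at hj hj'; omega
      rw [hzero j this]; norm_num
    rw [tailEnergy, Finset.sum_Ico_eq_sub _ (le_min hrm hrn), ← h3, h4, h1]
    simp

end TruncatedSVD

/-! ### Error of projecting onto the sketched range and co-range -/

section RangeError

variable {𝕜 : Type*} [RCLike 𝕜] {m n k s r : ℕ}

lemma IsThinQR.sub_proj_eq_zero {Y Q : Matrix (Fin m) (Fin k) 𝕜} {R : Matrix (Fin k) (Fin k) 𝕜}
    (h : IsThinQR Y Q R) : Y - Q * (Qᴴ * Y) = 0 := by
  rw [h.factorization, ← Matrix.mul_assoc Qᴴ, h.orthonormal, Matrix.one_mul, sub_self]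

lemma IsThinQRRule.orthonormal {qr : Matrix (Fin m) (Fin k) 𝕜 → Matrix (Fin m) (Fin k) 𝕜}
    (h : IsThinQRRule qr) (Y : Matrix (Fin m) (Fin k) 𝕜) : (qr Y)ᴴ * qr Y = 1 :=
  (h.isThinQR Y).choose_spec.orthonormal

lemma IsThinQRRule.sub_proj_eq_zero {qr : Matrix (Fin m) (Fin k) 𝕜 → Matrix (Fin m) (Fin k) 𝕜}
    (h : IsThinQRRule qr) (Y : Matrix (Fin m) (Fin k) 𝕜) : Y - qr Y * ((qr Y)ᴴ * Y) = 0 :=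
  (h.isThinQR Y).choose_spec.sub_proj_eq_zero

/-- Deterministic bound for the error of the projection onto the sketched range and co-range. -/
lemma frobSq_two_sided_projection_le {A : Matrix (Fin m) (Fin n) 𝕜}
    {Q : Matrix (Fin m) (Fin k) 𝕜} (hQ : Qᴴ * Q = 1) {P : Matrix (Fin n) (Fin k) 𝕜}
    (hP : Pᴴ * P = 1) {U : Matrix (Fin m) (Fin r) 𝕜} {V : Matrix (Fin n) (Fin r) 𝕜}
    (hV : Vᴴ * V = 1) (hUV : U * (Uᴴ * A) = A * V * Vᴴ)
    {Υ : Matrix (Fin k) (Fin m) 𝕜} {Ω : Matrix (Fin k) (Fin n) 𝕜}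
    (hΩ : A * Ωᴴ - Q * (Qᴴ * (A * Ωᴴ)) = 0) (hΥ : (Υ * A)ᴴ - P * (Pᴴ * (Υ * A)ᴴ) = 0)
    (hdΩ : ((Ω * V)ᴴ * (Ω * V)).det ≠ 0) (hdΥ : ((Υ * U)ᴴ * (Υ * U)).det ≠ 0) :
    frobSq (A - Q * (Qᴴ * A * P) * Pᴴ)
      ≤ frobSq ((A - A * V * Vᴴ) - Q * (Qᴴ * (A - A * V * Vᴴ)))
        + frobSq (leftInv (Ω * V) * (Ω * (A - A * V * Vᴴ)ᴴ))
        + frobSq (Qᴴ * (A - A * V * Vᴴ) + -(Qᴴ * U) * (leftInv (Υ * U) * (Υ * (A - A * V * Vᴴ)))) := by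
  rw [frobSq_sub_two_sided hQ, frobSq_split_right hV (A - Q * (Qᴴ * A))]
  set A₂ := A - A * V * Vᴴ with hA₂
  have e1 : A - Q * (Qᴴ * A) - (A - Q * (Qᴴ * A)) * V * Vᴴ = A₂ - Q * (Qᴴ * A₂) := by
    rw [hA₂]
    simp only [Matrix.mul_sub, Matrix.sub_mul, Matrix.mul_assoc]
    abel
  -- Since `Q` captures `A Ωᴴ`, the residual `B` satisfies `Ω Bᴴ = 0`. The regression identity then
  -- expresses `Vᴴ Bᴴ` through the part of `Bᴴ` orthogonal to `V`, which is `A₂ᴴ (1 - Q Qᴴ)`.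
  have h2 : frobSq ((A - Q * (Qᴴ * A)) * V) ≤ frobSq (leftInv (Ω * V) * (Ω * A₂ᴴ)) := by
    set B := A - Q * (Qᴴ * A) with hB
    have hB0 : Ω * Bᴴ = 0 := by
      rw [← Matrix.conjTranspose_conjTranspose Ω, ← Matrix.conjTranspose_mul, hB, Matrix.sub_mul,
        Matrix.mul_assoc, Matrix.mul_assoc, hΩ, Matrix.conjTranspose_zero]
    have h1 := leftInv_mul_mul_eq hdΩ Bᴴ
    have h3 : Bᴴ - V * (Vᴴ * Bᴴ) = A₂ᴴ - A₂ᴴ * Q * Qᴴ := by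
      rw [← Matrix.conjTranspose_conjTranspose (Bᴴ - _), conjTranspose_conjTranspose_sub_proj, e1]
      simp only [Matrix.conjTranspose_sub, Matrix.conjTranspose_mul,
        Matrix.conjTranspose_conjTranspose]
    rw [hB0, Matrix.mul_zero, h3] at h1
    have h4 : Vᴴ * Bᴴ = -(leftInv (Ω * V) * (Ω * A₂ᴴ) - leftInv (Ω * V) * (Ω * A₂ᴴ) * Q * Qᴴ) := by
      rw [eq_neg_of_add_eq_zero_left h1.symm]
      simp only [Matrix.mul_sub, Matrix.mul_assoc]
    rw [← frobSq_conjTranspose, Matrix.conjTranspose_mul, h4, frobSq_neg]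
    exact frobSq_sub_mul_proj_le hQ _
  -- Likewise `Υ B = 0` determines `Uᴴ B`. Offset and noise stay in one norm, so that averaging over
  -- `Υ` can remove their cross term.
  have h5 : frobSq (Qᴴ * A - Qᴴ * A * P * Pᴴ)
      ≤ frobSq (Qᴴ * A₂ + -(Qᴴ * U) * (leftInv (Υ * U) * (Υ * A₂))) := by
    set B := A - A * P * Pᴴ with hB
    have hB0 : Υ * B = 0 := by
      have := congrArg Matrix.conjTranspose hΥ
      rw [conjTranspose_conjTranspose_sub_proj, Matrix.conjTranspose_zero] at this
      rw [hB, Matrix.mul_sub, ← this]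
      simp only [Matrix.mul_assoc]
    have h1 := leftInv_mul_mul_eq hdΥ B
    have h3 : B - U * (Uᴴ * B) = A₂ - A₂ * P * Pᴴ := by
      have h6 : U * (Uᴴ * B) = U * (Uᴴ * A) - U * (Uᴴ * A) * P * Pᴴ := by
        rw [hB]; simp only [Matrix.mul_sub, Matrix.mul_assoc]
      rw [h6, hUV, hB, hA₂]
      simp only [Matrix.sub_mul]
      abel
    rw [hB0, Matrix.mul_zero, h3] at h1
    have h4 := eq_neg_of_add_eq_zero_left h1.symm
    have h7 : Qᴴ * A - Qᴴ * A * P * Pᴴ = Qᴴ * (U * (Uᴴ * B) + (B - U * (Uᴴ * B))) := by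
      rw [add_sub_cancel, hB, Matrix.mul_sub]; simp only [Matrix.mul_assoc]
    have h8 : Qᴴ * (U * (Uᴴ * B) + (B - U * (Uᴴ * B)))
        = (Qᴴ * A₂ + -(Qᴴ * U) * (leftInv (Υ * U) * (Υ * A₂)))
          - (Qᴴ * A₂ + -(Qᴴ * U) * (leftInv (Υ * U) * (Υ * A₂))) * P * Pᴴ := by
      rw [h3, h4]
      simp only [Matrix.mul_sub, Matrix.mul_add, Matrix.add_mul, Matrix.mul_neg, Matrix.neg_mul,
        Matrix.mul_assoc]
      abel
    rw [h7, h8]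
    exact frobSq_sub_mul_proj_le hP _
  rw [e1]
  linarith

/-- The factor `Q` depends on `Ω` alone, so in the inner integral over `Υ` it is constant and `Qᴴ
A₂` is a fixed offset. -/
lemma lintegral_range_error_le {A : Matrix (Fin m) (Fin n) 𝕜}
    {qrQ : Matrix (Fin m) (Fin k) 𝕜 → Matrix (Fin m) (Fin k) 𝕜} (hqrQ : IsThinQRRule qrQ)
    {qrP : Matrix (Fin n) (Fin k) 𝕜 → Matrix (Fin n) (Fin k) 𝕜} (hqrP : IsThinQRRule qrP)
    (hr : r + alpha 𝕜 < k) {U : Matrix (Fin m) (Fin r) 𝕜} {V : Matrix (Fin n) (Fin r) 𝕜}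
    (hU : Uᴴ * U = 1) (hV : Vᴴ * V = 1) (hUV : U * (Uᴴ * A) = A * V * Vᴴ) :
    ∫⁻ Ω, ∫⁻ Υ, ENNReal.ofReal (frobSq (A - qrQ (A * Ωᴴ) *
        ((qrQ (A * Ωᴴ))ᴴ * A * qrP (Υ * A)ᴴ) * (qrP (Υ * A)ᴴ)ᴴ))
      ∂(gaussianMatrix 𝕜 k m) ∂(gaussianMatrix 𝕜 k n)
      ≤ ENNReal.ofReal ((k + r - alpha 𝕜) / (k - r - alpha 𝕜) * frobSq (A - A * V * Vᴴ)) := by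
  have hpos : (0 : ℝ) < k - r - alpha 𝕜 := by
    have : (r : ℝ) + alpha 𝕜 < k := by exact_mod_cast hr
    linarith
  set c : ℝ := r / (k - r - alpha 𝕜) with hc
  have hc0 : 0 ≤ c := by positivity
  set A₂ := A - A * V * Vᴴ with hA₂
  have hUA : Uᴴ * A₂ = 0 := by
    rw [hA₂, ← hUV]; exact conjTranspose_mul_sub_proj hU A
  have hVA : Vᴴ * A₂ᴴ = 0 := by
    rw [← Matrix.conjTranspose_mul, hA₂, Matrix.sub_mul, Matrix.mul_assoc _ Vᴴ, hV, Matrix.mul_one,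
      sub_self, Matrix.conjTranspose_zero]
  have n0 := frobSq_nonneg A₂
  have inner_bound : ∀ᵐ Ω ∂(gaussianMatrix 𝕜 k n),
      ∫⁻ Υ, ENNReal.ofReal (frobSq (A - qrQ (A * Ωᴴ) *
        ((qrQ (A * Ωᴴ))ᴴ * A * qrP (Υ * A)ᴴ) * (qrP (Υ * A)ᴴ)ᴴ)) ∂(gaussianMatrix 𝕜 k m)
      ≤ ENNReal.ofReal ((1 + c) * frobSq A₂)
        + ENNReal.ofReal (frobSq (leftInv (Ω * V) * (Ω * A₂ᴴ))) := by
    filter_upwards [ae_det_mul_isometry_ne_zero hr hV] with Ω hΩ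
    have hQ := hqrQ.orthonormal (A * Ωᴴ)
    have hQY := hqrQ.sub_proj_eq_zero (A * Ωᴴ)
    set Q := qrQ (A * Ωᴴ)
    have hB : ∀ Y : Matrix (Fin r) (Fin n) 𝕜, frobSq (-(Qᴴ * U) * Y) ≤ frobSq Y := fun Y => by
      rw [Matrix.neg_mul, frobSq_neg, Matrix.mul_assoc]
      exact (frobSq_conjTranspose_isometry_mul_le hQ _).trans (frobSq_isometry_mul hU Y).le
    have hreg := lintegral_frobSq_add_regression_le hr hU hUA (Qᴴ * A₂) hB
    have n1 := frobSq_nonneg (A₂ - Q * (Qᴴ * A₂))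
    have n2 := frobSq_nonneg (leftInv (Ω * V) * (Ω * A₂ᴴ))
    have n3 := frobSq_nonneg (Qᴴ * A₂)
    calc _ ≤ ∫⁻ Υ, (ENNReal.ofReal (frobSq (A₂ - Q * (Qᴴ * A₂))
            + frobSq (leftInv (Ω * V) * (Ω * A₂ᴴ)))
          + ENNReal.ofReal (frobSq (Qᴴ * A₂ + -(Qᴴ * U) * (leftInv (Υ * U) * (Υ * A₂)))))
          ∂(gaussianMatrix 𝕜 k m) := by
          refine lintegral_mono_ae ?_
          filter_upwards [ae_det_mul_isometry_ne_zero hr hU] with Υ hΥ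
          rw [← ENNReal.ofReal_add (add_nonneg n1 n2) (frobSq_nonneg _)]
          exact ENNReal.ofReal_le_ofReal (frobSq_two_sided_projection_le hQ
            (hqrP.orthonormal _) hV hUV hQY (hqrP.sub_proj_eq_zero _) hΩ hΥ)
      _ ≤ ENNReal.ofReal (frobSq (A₂ - Q * (Qᴴ * A₂)) + frobSq (leftInv (Ω * V) * (Ω * A₂ᴴ)))
          + ENNReal.ofReal (frobSq (Qᴴ * A₂) + c * frobSq A₂) := by
          rw [lintegral_add_left (by fun_prop)]
          exact add_le_add (by simp) hreg
      _ = _ := by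
          rw [← ENNReal.ofReal_add (by positivity) (by positivity),
            ← ENNReal.ofReal_add (by positivity) n2]
          -- The `Qᴴ A₂` term from the `Υ`-regression completes `A₂ - Q Qᴴ A₂` to the full `‖A₂‖²`,
          -- so `A₂` is counted once.
          congr 1
          rw [add_mul, one_mul]
          linarith [frobSq_split_left hQ A₂]
  have hreg := lintegral_frobSq_leftInv_mul_mul_le hr hV hVA
  rw [frobSq_conjTranspose] at hreg
  refine (lintegral_mono_ae inner_bound).trans ?_
  rw [lintegral_add_left (by fun_prop)]
  refine (add_le_add (le_of_eq (by simp)) hreg).trans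
    (b := ENNReal.ofReal ((1 + c) * frobSq A₂) + _) ?_
  rw [← ENNReal.ofReal_add (by positivity) (by positivity)]
  refine ENNReal.ofReal_le_ofReal (le_of_eq ?_)
  have e4 : ((k : ℝ) + r - alpha 𝕜) / (k - r - alpha 𝕜) = 1 + 2 * c := by
    rw [hc]; field_simp; ring
  rw [e4, ← hc]
  ring

end RangeError

/-! ### Combining the two errors under the joint law -/

section Assembly

variable {𝕜 : Type*} [RCLike 𝕜] {m n k s : ℕ}

@[fun_prop]
lemma measurable_coreApproxLeftInv {S : Type*} [MeasurableSpace S]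
    {Q : S → Matrix (Fin m) (Fin k) 𝕜} {P : S → Matrix (Fin n) (Fin k) 𝕜}
    {Φ : S → Matrix (Fin s) (Fin m) 𝕜} {Ψ : S → Matrix (Fin s) (Fin n) 𝕜}
    (A : Matrix (Fin m) (Fin n) 𝕜) (hQ : Measurable Q) (hP : Measurable P) (hΦ : Measurable Φ)
    (hΨ : Measurable Ψ) : Measurable fun x => coreApproxLeftInv (Q x) (P x) A (Φ x) (Ψ x) := by
  unfold coreApproxLeftInv; fun_prop

/-- The truncation may have rank `d < r`; the factor increases with the rank, so its value at `r` is
still a bound. -/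
lemma lintegral_range_error_le_tailEnergy (hkm : k ≤ m) (hkn : k ≤ n) (A : Matrix (Fin m) (Fin n) 𝕜)
    {qrQ : Matrix (Fin m) (Fin k) 𝕜 → Matrix (Fin m) (Fin k) 𝕜} (hqrQ : IsThinQRRule qrQ)
    {qrP : Matrix (Fin n) (Fin k) 𝕜 → Matrix (Fin n) (Fin k) 𝕜} (hqrP : IsThinQRRule qrP)
    {r : ℕ} (hr : r + alpha 𝕜 < k) :
    ∫⁻ Ω, ∫⁻ Υ, ENNReal.ofReal (frobSq (A - qrQ (A * Ωᴴ) *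
        ((qrQ (A * Ωᴴ))ᴴ * A * qrP (Υ * A)ᴴ) * (qrP (Υ * A)ᴴ)ᴴ))
      ∂(gaussianMatrix 𝕜 k m) ∂(gaussianMatrix 𝕜 k n)
      ≤ ENNReal.ofReal ((k + r - alpha 𝕜) / (k - r - alpha 𝕜) * tailEnergy A r) := by
  obtain ⟨d, hd, U, V, hU, hV, hUV, htail⟩ :=
    exists_truncated_svd A (r := r) (by omega) (by omega)
  refine (lintegral_range_error_le hqrQ hqrP (by omega) hU hV hUV).trans
    (ENNReal.ofReal_le_ofReal ?_)
  have h0 : 0 ≤ tailEnergy A r := htail ▸ frobSq_nonneg _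
  have hpos : (0 : ℝ) < k - r - alpha 𝕜 := by
    have : (r : ℝ) + alpha 𝕜 < k := by exact_mod_cast hr
    linarith
  have hd' : (d : ℝ) ≤ r := by exact_mod_cast hd
  rw [htail]
  have hr0 : (0 : ℝ) ≤ r := Nat.cast_nonneg r
  exact mul_le_mul_of_nonneg_right (div_le_div₀ (by linarith) (by linarith) hpos (by linarith)) h0

/-- The squared error of the initial approximation as a function of the test matrices, computed with
`leftInv` in place of the pseudoinverse. -/
noncomputable def sketchError (qrQ : Matrix (Fin m) (Fin k) 𝕜 → Matrix (Fin m) (Fin k) 𝕜)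
    (qrP : Matrix (Fin n) (Fin k) 𝕜 → Matrix (Fin n) (Fin k) 𝕜) (A : Matrix (Fin m) (Fin n) 𝕜)
    (x : Matrix (Fin k) (Fin m) 𝕜 × Matrix (Fin k) (Fin n) 𝕜 ×
      Matrix (Fin s) (Fin m) 𝕜 × Matrix (Fin s) (Fin n) 𝕜) : ℝ :=
  frobSq (A - qrQ (A * x.2.1ᴴ) *
    coreApproxLeftInv (qrQ (A * x.2.1ᴴ)) (qrP (x.1 * A)ᴴ) A x.2.2.1 x.2.2.2 * (qrP (x.1 * A)ᴴ)ᴴ)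

variable (𝕜 m n k s) in
/-- The joint law of the test matrices. -/
noncomputable def sketchLaw : Measure (Matrix (Fin k) (Fin m) 𝕜 × Matrix (Fin k) (Fin n) 𝕜 ×
      Matrix (Fin s) (Fin m) 𝕜 × Matrix (Fin s) (Fin n) 𝕜) :=
  (gaussianMatrix 𝕜 k m).prod ((gaussianMatrix 𝕜 k n).prod
    ((gaussianMatrix 𝕜 s m).prod (gaussianMatrix 𝕜 s n)))

lemma measurable_sketchError {qrQ : Matrix (Fin m) (Fin k) 𝕜 → Matrix (Fin m) (Fin k) 𝕜}
    (hmQ : Measurable qrQ) {qrP : Matrix (Fin n) (Fin k) 𝕜 → Matrix (Fin n) (Fin k) 𝕜}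
    (hmP : Measurable qrP) (A : Matrix (Fin m) (Fin n) 𝕜) :
    Measurable (sketchError (s := s) qrQ qrP A) := by
  unfold sketchError; fun_prop

/-- Given `Υ` and `Ω`, the factors `Q` and `P` are constant isometries, so `Φ Q` and `Ψ P` have full
column rank almost surely. This also makes the true error almost everywhere measurable. -/
lemma frobSq_initialApprox_ae_eq (hs : k + alpha 𝕜 < s) (A : Matrix (Fin m) (Fin n) 𝕜)
    {qrQ : Matrix (Fin m) (Fin k) 𝕜 → Matrix (Fin m) (Fin k) 𝕜} (hqrQ : IsThinQRRule qrQ)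
    {qrP : Matrix (Fin n) (Fin k) 𝕜 → Matrix (Fin n) (Fin k) 𝕜} (hqrP : IsThinQRRule qrP) :
    (fun x => frobSq (A - initialApprox qrQ qrP A x.1 x.2.1 x.2.2.1 x.2.2.2))
      =ᵐ[sketchLaw 𝕜 m n k s] sketchError qrQ qrP A := by
  have hmQ : Measurable qrQ := hqrQ.measurable
  have hmP : Measurable qrP := hqrP.measurable
  let E := Matrix (Fin k) (Fin m) 𝕜 × Matrix (Fin k) (Fin n) 𝕜 ×
      Matrix (Fin s) (Fin m) 𝕜 × Matrix (Fin s) (Fin n) 𝕜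
  let D : Set E := {x | ((x.2.2.1 * qrQ (A * x.2.1ᴴ))ᴴ * (x.2.2.1 * qrQ (A * x.2.1ᴴ))).det ≠ 0 ∧
    ((x.2.2.2 * qrP (x.1 * A)ᴴ)ᴴ * (x.2.2.2 * qrP (x.1 * A)ᴴ)).det ≠ 0}
  have hdet : Measurable fun X : Matrix (Fin k) (Fin k) 𝕜 => X.det :=
    (continuous_id.matrix_det).measurable
  have hD : MeasurableSet D := by
    refine MeasurableSet.inter ?_ ?_
    · exact (hdet.comp (f := fun x : E => (x.2.2.1 * qrQ (A * x.2.1ᴴ))ᴴ *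
        (x.2.2.1 * qrQ (A * x.2.1ᴴ))) (by fun_prop)) (measurableSet_singleton 0).compl
    · exact (hdet.comp (f := fun x : E => (x.2.2.2 * qrP (x.1 * A)ᴴ)ᴴ *
        (x.2.2.2 * qrP (x.1 * A)ᴴ)) (by fun_prop)) (measurableSet_singleton 0).compl
  have hDae : ∀ᵐ x ∂(sketchLaw 𝕜 m n k s), x ∈ D := by
    rw [sketchLaw, Measure.ae_prod_mem_iff_ae_ae_mem hD]
    refine Filter.Eventually.of_forall fun y => ?_
    have hD1 := measurable_prodMk_left (x := y) hD
    refine (Measure.ae_prod_mem_iff_ae_ae_mem hD1).2 (Filter.Eventually.of_forall fun w => ?_)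
    have hD2 := measurable_prodMk_left (x := w) hD1
    refine (Measure.ae_prod_mem_iff_ae_ae_mem hD2).2 ?_
    filter_upwards [ae_det_mul_isometry_ne_zero hs (hqrQ.orthonormal (A * wᴴ))] with φ hφ
    filter_upwards [ae_det_mul_isometry_ne_zero hs (hqrP.orthonormal (y * A)ᴴ)] with ψ hψ
    exact ⟨hφ, hψ⟩
  filter_upwards [hDae] with x hx
  simp only [sketchError, initialApprox, coreApprox, coreSketch, rangeSketch, corangeSketch,
    coreApproxLeftInv]
  rw [pinv_eq_leftInv hx.1, pinv_eq_leftInv hx.2]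

lemma lintegral_prod_four {α β γ δ : Type*} [MeasurableSpace α] [MeasurableSpace β]
    [MeasurableSpace γ] [MeasurableSpace δ] (μ₁ : Measure α) (μ₂ : Measure β) (μ₃ : Measure γ)
    (μ₄ : Measure δ) [SFinite μ₂] [SFinite μ₃] [SFinite μ₄] {f : α × β × γ × δ → ENNReal}
    (hf : Measurable f) :
    ∫⁻ x, f x ∂(μ₁.prod (μ₂.prod (μ₃.prod μ₄)))
      = ∫⁻ a, ∫⁻ b, ∫⁻ c, ∫⁻ d, f (a, b, c, d) ∂μ₄ ∂μ₃ ∂μ₂ ∂μ₁ := by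
  rw [lintegral_prod _ hf.aemeasurable]
  refine lintegral_congr fun a => ?_
  rw [lintegral_prod (fun y => f (a, y)) (by fun_prop)]
  refine lintegral_congr fun b => ?_
  rw [lintegral_prod (fun y => f (a, b, y)) (by fun_prop)]

lemma lintegral_sketchError_le (hkm : k ≤ m) (hkn : k ≤ n) (hk : 0 < k)
    (hs : 2 * k + alpha 𝕜 ≤ s) (A : Matrix (Fin m) (Fin n) 𝕜)
    {qrQ : Matrix (Fin m) (Fin k) 𝕜 → Matrix (Fin m) (Fin k) 𝕜} (hqrQ : IsThinQRRule qrQ)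
    {qrP : Matrix (Fin n) (Fin k) 𝕜 → Matrix (Fin n) (Fin k) 𝕜} (hqrP : IsThinQRRule qrP)
    {r : ℕ} (hr : r + alpha 𝕜 < k) :
    ∫⁻ x, ENNReal.ofReal (sketchError qrQ qrP A x) ∂(sketchLaw 𝕜 m n k s)
      ≤ ENNReal.ofReal ((s - alpha 𝕜) / (s - k - alpha 𝕜) *
        ((k + r - alpha 𝕜) / (k - r - alpha 𝕜) * tailEnergy A r)) := by
  have hmQ : Measurable qrQ := hqrQ.measurable
  have hmP : Measurable qrP := hqrP.measurable
  set a : ℝ := ((s : ℝ) - alpha 𝕜) / ((s : ℝ) - k - alpha 𝕜)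
  set b : ℝ := ((k : ℝ) + r - alpha 𝕜) / ((k : ℝ) - r - alpha 𝕜) * tailEnergy A r
  have ha0 : 0 ≤ a := by
    have h1 : (2 : ℝ) * k + alpha 𝕜 ≤ s := by exact_mod_cast hs
    have h2 : (0 : ℝ) ≤ k := Nat.cast_nonneg k
    exact div_nonneg (by linarith) (by linarith)
  let R : Matrix (Fin k) (Fin m) 𝕜 → Matrix (Fin k) (Fin n) 𝕜 → ENNReal := fun y w =>
    ENNReal.ofReal (frobSq (A - qrQ (A * wᴴ) *
      ((qrQ (A * wᴴ))ᴴ * A * qrP (y * A)ᴴ) * (qrP (y * A)ᴴ)ᴴ))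
  have hR : Measurable (Function.uncurry R) := by
    change Measurable fun x : Matrix (Fin k) (Fin m) 𝕜 × Matrix (Fin k) (Fin n) 𝕜 =>
        ENNReal.ofReal (frobSq (A - qrQ (A * x.2ᴴ) *
        ((qrQ (A * x.2ᴴ))ᴴ * A * qrP (x.1 * A)ᴴ) * (qrP (x.1 * A)ᴴ)ᴴ))
    fun_prop
  have hRy : ∀ y, Measurable (R y) := fun y => by simp only [R]; fun_prop
  have hG : Measurable fun x => ENNReal.ofReal (sketchError (s := s) qrQ qrP A x) :=
    (measurable_sketchError hmQ hmP A).ennreal_ofReal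
  calc ∫⁻ x, ENNReal.ofReal (sketchError qrQ qrP A x) ∂(sketchLaw 𝕜 m n k s)
      = ∫⁻ y, ∫⁻ w, ∫⁻ φ, ∫⁻ ψ, ENNReal.ofReal (sketchError qrQ qrP A (y, w, φ, ψ))
          ∂(gaussianMatrix 𝕜 s n) ∂(gaussianMatrix 𝕜 s m) ∂(gaussianMatrix 𝕜 k n)
          ∂(gaussianMatrix 𝕜 k m) :=
        lintegral_prod_four _ _ _ _ hG
    _ ≤ ∫⁻ y, ∫⁻ w, ENNReal.ofReal a * R y w ∂(gaussianMatrix 𝕜 k n) ∂(gaussianMatrix 𝕜 k m) := by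
        refine lintegral_mono fun y => lintegral_mono fun w => ?_
        rw [← ENNReal.ofReal_mul ha0]
        exact lintegral_core_error_le hs hk (hqrQ.orthonormal (A * wᴴ))
          (hqrP.orthonormal (y * A)ᴴ) A
    -- The integrals are exchanged so that `Ω` is outermost, as the range estimate requires.
    _ = ENNReal.ofReal a * ∫⁻ w, ∫⁻ y, R y w ∂(gaussianMatrix 𝕜 k m) ∂(gaussianMatrix 𝕜 k n) := by
        rw [← lintegral_lintegral_swap hR.aemeasurable,
          ← lintegral_const_mul _ (Measurable.lintegral_prod_right hR)]
        exact lintegral_congr fun y => lintegral_const_mul _ (hRy y)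
    _ ≤ ENNReal.ofReal a * ENNReal.ofReal b :=
        mul_le_mul_right (lintegral_range_error_le_tailEnergy hkm hkn A hqrQ hqrP hr) _
    _ = ENNReal.ofReal (a * b) := (ENNReal.ofReal_mul ha0).symm

end Assembly

end LowRankSketch

open LowRankSketch in
theorem theorem5p1 {𝕜 : Type*} [RCLike 𝕜] {m n k s : ℕ}
    (hkm : k ≤ m) (hkn : k ≤ n)
    (hk : LowRankSketch.alpha 𝕜 < k)
    (hs : 2 * k + LowRankSketch.alpha 𝕜 ≤ s)
    (A : Matrix (Fin m) (Fin n) 𝕜)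
    (qrQ : Matrix (Fin m) (Fin k) 𝕜 → Matrix (Fin m) (Fin k) 𝕜)
    (hqrQ : LowRankSketch.IsThinQRRule qrQ)
    (qrP : Matrix (Fin n) (Fin k) 𝕜 → Matrix (Fin n) (Fin k) 𝕜)
    (hqrP : LowRankSketch.IsThinQRRule qrP)
    {S : Type*} [MeasurableSpace S] (μ : Measure S) [IsProbabilityMeasure μ]
    (Υ : S → Matrix (Fin k) (Fin m) 𝕜) (Ω : S → Matrix (Fin k) (Fin n) 𝕜)
    (Φ : S → Matrix (Fin s) (Fin m) 𝕜) (Ψ : S → Matrix (Fin s) (Fin n) 𝕜)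
    (hlaw : HasLaw (fun ω => (Υ ω, Ω ω, Φ ω, Ψ ω))
      ((LowRankSketch.gaussianMatrix 𝕜 k m).prod ((LowRankSketch.gaussianMatrix 𝕜 k n).prod
        ((LowRankSketch.gaussianMatrix 𝕜 s m).prod (LowRankSketch.gaussianMatrix 𝕜 s n)))) μ) :
    Integrable (fun ω => LowRankSketch.frobSq
      (A - LowRankSketch.initialApprox qrQ qrP A (Υ ω) (Ω ω) (Φ ω) (Ψ ω))) μ ∧
    ∫ ω, LowRankSketch.frobSq
      (A - LowRankSketch.initialApprox qrQ qrP A (Υ ω) (Ω ω) (Φ ω) (Ψ ω)) ∂μ ≤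
      ((s : ℝ) - LowRankSketch.alpha 𝕜) / ((s : ℝ) - k - LowRankSketch.alpha 𝕜) *
        (Finset.range (k - LowRankSketch.alpha 𝕜)).inf'
          (Finset.nonempty_range_iff.mpr (Nat.sub_ne_zero_of_lt hk))
          (fun ϱ : ℕ => ((k : ℝ) + ϱ - LowRankSketch.alpha 𝕜) /
            ((k : ℝ) - ϱ - LowRankSketch.alpha 𝕜) * LowRankSketch.tailEnergy A ϱ) := by
  have hmQ : Measurable qrQ := hqrQ.measurable
  have hmP : Measurable qrP := hqrP.measurable
  obtain ⟨r, hr, hrmin⟩ := Finset.exists_mem_eq_inf' (s := Finset.range (k - alpha 𝕜))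
    (Finset.nonempty_range_iff.mpr (Nat.sub_ne_zero_of_lt hk))
    (fun ϱ : ℕ => ((k : ℝ) + ϱ - alpha 𝕜) / ((k : ℝ) - ϱ - alpha 𝕜) * tailEnergy A ϱ)
  rw [hrmin]
  have hrk : r + alpha 𝕜 < k := by have := Finset.mem_range.1 hr; omega
  have hbound := lintegral_sketchError_le hkm hkn (by omega) hs A hqrQ hqrP hrk
  have hFG := frobSq_initialApprox_ae_eq (s := s) (by omega) A hqrQ hqrP
  set b : ℝ := ((s : ℝ) - alpha 𝕜) / ((s : ℝ) - k - alpha 𝕜) *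
    (((k : ℝ) + r - alpha 𝕜) / ((k : ℝ) - r - alpha 𝕜) * tailEnergy A r) with hb
  have hb0 : 0 ≤ b := by
    have h1 : (r : ℝ) + alpha 𝕜 < k := by exact_mod_cast hrk
    have h2 : (0 : ℝ) ≤ r := Nat.cast_nonneg r
    have h3 : (2 : ℝ) * k + alpha 𝕜 ≤ s := by exact_mod_cast hs
    have h4 : (0 : ℝ) ≤ k := Nat.cast_nonneg k
    exact mul_nonneg (div_nonneg (by linarith) (by linarith))
      (mul_nonneg (div_nonneg (by linarith) (by linarith))
        (Finset.sum_nonneg fun _ _ => sq_nonneg _))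
  have hG := measurable_sketchError (s := s) hmQ hmP A
  have hG0 : ∀ x, 0 ≤ sketchError (s := s) qrQ qrP A x := fun x => frobSq_nonneg _
  -- Integrability is part of the claim; it follows from finiteness of the bound on the lower
  -- integral.
  have hGint : Integrable (sketchError qrQ qrP A) (sketchLaw 𝕜 m n k s) := by
    refine ⟨hG.aestronglyMeasurable, ?_⟩
    rw [hasFiniteIntegral_iff_ofReal (Filter.Eventually.of_forall hG0)]
    exact hbound.trans_lt ENNReal.ofReal_lt_top
  have hGle : ∫ x, sketchError qrQ qrP A x ∂(sketchLaw 𝕜 m n k s) ≤ b := by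
    rw [integral_eq_lintegral_of_nonneg_ae (Filter.Eventually.of_forall hG0)
      hG.aestronglyMeasurable]
    exact ENNReal.toReal_le_of_le_ofReal hb0 hbound
  have hFint := hGint.congr hFG.symm
  have hmap : μ.map (fun ω => (Υ ω, Ω ω, Φ ω, Ψ ω)) = sketchLaw 𝕜 m n k s := hlaw.map_eq
  rw [← hmap] at hFint
  refine ⟨hFint.comp_aemeasurable hlaw.aemeasurable, ?_⟩
  have h1 := integral_map hlaw.aemeasurable hFint.aestronglyMeasurable
  rw [hmap, integral_congr_ae hFG] at h1
  exact h1.symm.trans_le hGle
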